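/- A seller offers two divisible goods, at most one unit of each, to a buyer whose type $\mathbf x=(x_1,x_2)$ is distributed on $\mathcal X=[0,1]^2$ with density $f$. A buyer of type $\mathbf x$ who gets the bundle $\mathbf q\in[0,1]^2$ at price $t$ has utility $\mathbf x\cdot\mathbf q-t$. Put $\phi(\mathbf x)=\mathbf x\cdot\nabla f(\mathbf x)+3f(\mathbf x)$. Assume that $f$ is continuous on $\mathcal X$ and continuously differentiable on its interior, that $\phi$ is bounded on the interior, that $f(t,1)>0$ and $f(1,t)>0$ for almost every $t\in[0,1]$, that $\phi>0$ almost everywhere on $\mathcal X$ (strict regularity), and that $f(x_1,x_2)=f(x_2,x_1)$ (symmetry). For $x_1\in(0,1)$ let $$\zeta(x_1)=\sup\Big\{z\in[0,1]:\int_z^1\phi(x_1,x_2)\,dx_2-f(x_1,1)\ge 0\Big\},\qquad \sup\emptyset=0.$$ A mechanism is a price schedule $p:[0,1]^2\to\mathbb R$, bounded below, with $p(\mathbf 0)=0$. Its indirect utility is $u(\mathbf x)=\sup_{\mathbf q\in[0,1]^2}\{\mathbf x\cdot\mathbf q-p(\mathbf q)\}$, and $\overline u(t)=u(t,1)$. It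 is optimal if it maximizes the revenue $\int_{\mathcal X}[\mathbf x\cdot\nabla u(\mathbf x)-u(\mathbf x)]f(\mathbf x)\,d\mathbf x$ among all mechanisms, and symmetric if $u(x_1,x_2)=u(x_2,x_1)$ on $\mathcal X$. The demand set $\mathcal D(\mathbf q)$ is the set of all $\mathbf x\in\mathcal X$ such that $\mathbf x\cdot\mathbf q-u(\mathbf x)\ge\hat{\mathbf x}\cdot\mathbf q-u(\hat{\mathbf x})$ for all $\hat{\mathbf x}\in\mathcal X$. A bundle $\mathbf q\neq\mathbf 0$ is active if, for every $\delta>0$, $\bigcup_{\hat{\mathbf q}\in[0,1]^2,\ \lVert\hat{\mathbf q}-\mathbf q\rVert<\delta}\mathcal D(\hat{\mathbf q})$ has positive measure with respect to $f$. If $\zeta$ is convex on $(0,1)$ (in particular, if it is convex on $[0,1]$), then for every symmetric optimal mechanism there are $a^1\in[0,1)$ and $q\in[0,1)$ such that $\overline u'(x)=q$ for $x\in[0,a^1)$ and $\overline u'(x)=1$ for $x\in[a^1,1]$, where derivatives at $0$ and at $a^1$ are right derivatives and the derivative at $1$ is a left derivative. Moreover every active bundle is one of $(q,1)$, $(1,q)$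 and $(1,1)$; in particular there are at most three. -/

import Mathlib

open MeasureTheory Set

noncomputable section

namespace TwoGoods

/-- The unit square `[0,1]²`. It is both the space of buyer types and the space of bundles. -/
def square : Set (ℝ × ℝ) := Icc 0 1 ×ˢ Icc 0 1

/-- `φ(x) = x · ∇f(x) + 3 f(x)`, to be read at interior points `x` of the square;
`fderiv ℝ f x x` is the derivative of `f` at `x` in the direction `x`, that is `x · ∇f(x)`. -/
def phi (f : ℝ × ℝ → ℝ) (x : ℝ × ℝ) : ℝ := fderiv ℝ f x x + 3 * f x

/-- The standing assumptions on the density `f` of the type distribution on the square. -/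
structure IsTypeDensity (f : ℝ × ℝ → ℝ) : Prop where
  nonneg : ∀ x ∈ square, 0 ≤ f x
  integral_eq_one : ∫ x in square, f x = 1
  continuousOn : ContinuousOn f square
  contDiffOn : ContDiffOn ℝ 1 f (interior square)
  phi_bounded : ∃ M : ℝ, ∀ x ∈ interior square, |phi f x| ≤ M
  pos_top : ∀ᵐ t ∂(volume.restrict (Icc (0 : ℝ) 1)), 0 < f (t, 1) ∧ 0 < f (1, t)

/-- The environment is strictly regular and symmetric. -/
structure IsSRS (f : ℝ × ℝ → ℝ) : Prop extends IsTypeDensity f where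
  strictlyRegular : ∀ᵐ x ∂(volume.restrict square), 0 < phi f x
  symmetric : ∀ x₁ ∈ Icc (0 : ℝ) 1, ∀ x₂ ∈ Icc (0 : ℝ) 1, f (x₁, x₂) = f (x₂, x₁)

/-- The threshold `ζ(x₁)`: the supremum of all `z ∈ [0,1]` at which
`∫_z^1 φ(x₁, x₂) dx₂ - f(x₁, 1) ≥ 0`, and `0` if there is none. It is used for `0 < x₁ < 1`, so
that the integrand is evaluated at interior points of the square up to a null set. -/
def zeta (f : ℝ × ℝ → ℝ) (x₁ : ℝ) : ℝ :=
  sSup {z : ℝ | z ∈ Icc (0 : ℝ) 1 ∧ 0 ≤ (∫ x₂ in z..1, phi f (x₁, x₂)) - f (x₁, 1)}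

/-- A price schedule: the zero bundle is free, and prices are bounded below, which is the same as
saying that every buyer's indirect utility is finite. Only the values on the square matter. -/
structure IsPriceSchedule (p : ℝ × ℝ → ℝ) : Prop where
  zero : p (0, 0) = 0
  bddBelow : BddBelow (p '' square)

/-- The indirect utility `u(x) = sup_q (x · q - p(q))` over all bundles `q`. -/
def utility (p : ℝ × ℝ → ℝ) (x : ℝ × ℝ) : ℝ :=
  ⨆ q : square, (x.1 * q.1.1 + x.2 * q.1.2 - p q.1)

/-- The indirect utility `ū(t) = u(t, 1)` along the top edge of the square. -/
def ubar (p : ℝ × ℝ → ℝ) (t : ℝ) : ℝ := utility p (t, 1)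

/-- The total revenue `∫ (x · ∇u(x) - u(x)) f(x) dx`. -/
def revenue (f p : ℝ × ℝ → ℝ) : ℝ :=
  ∫ x in square, (fderiv ℝ (utility p) x x - utility p x) * f x

/-- A price schedule that maximizes revenue among all price schedules. -/
structure IsOptimal (f p : ℝ × ℝ → ℝ) : Prop where
  isPriceSchedule : IsPriceSchedule p
  revenue_le : ∀ p' : ℝ × ℝ → ℝ, IsPriceSchedule p' → revenue f p' ≤ revenue f p

/-- The mechanism treats the two goods symmetrically: `u(x₁, x₂) = u(x₂, x₁)`. -/
def IsSymmetricMechanism (p : ℝ × ℝ → ℝ) : Prop :=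
  ∀ x₁ ∈ Icc (0 : ℝ) 1, ∀ x₂ ∈ Icc (0 : ℝ) 1, utility p (x₁, x₂) = utility p (x₂, x₁)

/-- The demand set of the bundle `q`: the types `x` with `q` in the subdifferential of `u` at `x`,
taken relative to the square. -/
def demandSet (p : ℝ × ℝ → ℝ) (q : ℝ × ℝ) : Set (ℝ × ℝ) :=
  {x | x ∈ square ∧ ∀ y ∈ square,
    y.1 * q.1 + y.2 * q.2 - utility p y ≤ x.1 * q.1 + x.2 * q.2 - utility p x}

/-- The distribution of types. -/
def typeMeasure (f : ℝ × ℝ → ℝ) : Measure (ℝ × ℝ) :=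
  (volume.restrict square).withDensity fun x => ENNReal.ofReal (f x)

/-- A nonzero bundle `q` is active if, for each `δ > 0`, the types who demand some bundle at
Euclidean distance less than `δ` from `q` have positive mass. -/
def IsActive (f p : ℝ × ℝ → ℝ) (q : ℝ × ℝ) : Prop :=
  q ∈ square ∧ q ≠ (0, 0) ∧ ∀ δ : ℝ, 0 < δ →
    0 < typeMeasure f (⋃ r ∈ {r : ℝ × ℝ | r ∈ square ∧
      Real.sqrt ((r.1 - q.1) ^ 2 + (r.2 - q.2) ^ 2) < δ}, demandSet p r)

end TwoGoods

end

/-! Integrating by parts along rays from the origin turns revenue into edge integrals of `u * f`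
minus the integral of `u * phi f` (`IsTypeDensity.integral_radial`). By symmetry this is twice an
integral over `t` of slice revenues, each involving only `u` on the vertical segment from `(t, t)`
to `(t, 1)`.

On a slice fix `y = ubar p t`. Since `phi f > 0`, revenue falls in the values of `u` below the top,
and `u (t, s) ≥ max 0 (y + s - 1)` because `u` is nonnegative with slope at most one. So
`segmentRevenue` at `y` bounds the slice (`IsPositiveProfile.sliceRevenue_le`). It is concave in
`y`, with slope `f (t, 1)` minus the tail integral of `phi f` from `max t (1 - y)`. Hence it
strictly increases on `y ≥ 0` if `zeta f t < t`, while for `0 < t < zeta f t` its strict peak is at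
`y = 1 - zeta f t`.

Convexity of `zeta f` enters twice. It makes `zeta f` cross the diagonal once, at some `τ < 1`
(`IsSRS.exists_crossing`), and it makes the target `1 - zeta f` concave. Between the convex `ubar p`
and this concave target there is an affine function with slope in `[0, 1]` on `(0, τ)`
(`exists_affine_between`). Its maximum with the slope-one line through `(τ, ubar p τ)` is, at every
`t ≠ τ`, either equal to `ubar p t` or strictly better for the slice. A menu `(q, 1)`, `(1, q)`,
`(1, 1)` has these top-edge values and attains the slice bound, so an optimal symmetric mechanism
must agree with it (`IsSRS.exists_menu_eq`). -/

noncomputable section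

namespace TwoGoods

/-! ### Indirect utilities: monotone, convex, with slopes at most one -/

lemma mem_square {x : ℝ × ℝ} :
    x ∈ square ↔ (0 ≤ x.1 ∧ x.1 ≤ 1) ∧ 0 ≤ x.2 ∧ x.2 ≤ 1 :=
  Iff.rfl

instance : Nonempty square := ⟨⟨(0, 0), by simp [mem_square]⟩⟩

lemma IsPriceSchedule.bddAbove_range {p : ℝ × ℝ → ℝ} (hp : IsPriceSchedule p) (x : ℝ × ℝ) :
    BddAbove (range fun q : square => x.1 * q.1.1 + x.2 * q.1.2 - p q.1) := by
  obtain ⟨c, hc⟩ := hp.bddBelow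
  refine ⟨|x.1| + |x.2| - c, ?_⟩
  rintro _ ⟨⟨q, hq⟩, rfl⟩
  have h0 : c ≤ p q := hc ⟨q, hq, rfl⟩
  rw [mem_square] at hq
  have h1 : x.1 * q.1 ≤ |x.1| := by
    nlinarith [le_abs_self x.1, abs_nonneg x.1]
  have h2 : x.2 * q.2 ≤ |x.2| := by
    nlinarith [le_abs_self x.2, abs_nonneg x.2]
  simp only
  linarith

lemma IsPriceSchedule.le_utility {p : ℝ × ℝ → ℝ} (hp : IsPriceSchedule p) (x : ℝ × ℝ)
    {q : ℝ × ℝ} (hq : q ∈ square) : x.1 * q.1 + x.2 * q.2 - p q ≤ utility p x :=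
  le_ciSup (hp.bddAbove_range x) (⟨q, hq⟩ : square)

lemma utility_le {p : ℝ × ℝ → ℝ} {x : ℝ × ℝ} {c : ℝ}
    (h : ∀ q ∈ square, x.1 * q.1 + x.2 * q.2 - p q ≤ c) : utility p x ≤ c :=
  ciSup_le fun q => h q.1 q.2

lemma IsPriceSchedule.utility_nonneg {p : ℝ × ℝ → ℝ} (hp : IsPriceSchedule p) (x : ℝ × ℝ) :
    0 ≤ utility p x := by
  have := hp.le_utility x (q := (0, 0)) (by simp [mem_square])
  simpa [hp.zero] using this

lemma IsPriceSchedule.utility_mono {p : ℝ × ℝ → ℝ} (hp : IsPriceSchedule p) {x y : ℝ × ℝ}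
    (h1 : x.1 ≤ y.1) (h2 : x.2 ≤ y.2) : utility p x ≤ utility p y := by
  refine utility_le fun q hq => (?_ : _ ≤ _).trans (hp.le_utility y hq)
  rw [mem_square] at hq
  nlinarith [mul_le_mul_of_nonneg_right h1 hq.1.1, mul_le_mul_of_nonneg_right h2 hq.2.1]

lemma IsPriceSchedule.utility_le_add {p : ℝ × ℝ → ℝ} (hp : IsPriceSchedule p) {x y : ℝ × ℝ}
    (h1 : x.1 ≤ y.1) (h2 : x.2 ≤ y.2) :
    utility p y ≤ utility p x + (y.1 - x.1) + (y.2 - x.2) := by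
  refine utility_le fun q hq => ?_
  have := hp.le_utility x hq
  rw [mem_square] at hq
  nlinarith [mul_le_mul_of_nonneg_left hq.1.2 (sub_nonneg.2 h1),
    mul_le_mul_of_nonneg_left hq.2.2 (sub_nonneg.2 h2)]

/-- The distance on `ℝ × ℝ` is the sup distance, and the two coordinates of a bundle sum to at most
`2`. -/
lemma IsPriceSchedule.lipschitzWith_utility {p : ℝ × ℝ → ℝ} (hp : IsPriceSchedule p) :
    LipschitzWith 2 (utility p) := by
  refine LipschitzWith.of_le_add_mul 2 fun x y => utility_le fun q hq => ?_
  have := hp.le_utility y hq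
  rw [mem_square] at hq
  have h1 : |x.1 - y.1| ≤ dist x y := by
    rw [← Real.dist_eq]; exact le_max_left _ _
  have h2 : |x.2 - y.2| ≤ dist x y := by
    rw [← Real.dist_eq]; exact le_max_right _ _
  have h3 : (x.1 - y.1) * q.1 ≤ |x.1 - y.1| := by
    nlinarith [le_abs_self (x.1 - y.1), abs_nonneg (x.1 - y.1)]
  have h4 : (x.2 - y.2) * q.2 ≤ |x.2 - y.2| := by
    nlinarith [le_abs_self (x.2 - y.2), abs_nonneg (x.2 - y.2)]
  simp only [NNReal.coe_ofNat]
  linarith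

/-- Convexity holds on the whole line, since the supremum makes sense off the square. The slope
bounds on separating lines will rely on this. -/
lemma IsPriceSchedule.convexOn_ubar {p : ℝ × ℝ → ℝ} (hp : IsPriceSchedule p) :
    ConvexOn ℝ univ (ubar p) := by
  refine ⟨convex_univ, fun x _ y _ a b ha hb hab => utility_le fun q hq => ?_⟩
  have hx := mul_le_mul_of_nonneg_left (hp.le_utility (x, 1) hq) ha
  have hy := mul_le_mul_of_nonneg_left (hp.le_utility (y, 1) hq) hb
  simp only [smul_eq_mul, ubar] at *
  obtain rfl : b = 1 - a := by linarith
  linarith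

lemma IsPriceSchedule.monotone_ubar {p : ℝ × ℝ → ℝ} (hp : IsPriceSchedule p) :
    Monotone (ubar p) := fun _ _ h => hp.utility_mono h le_rfl

lemma IsPriceSchedule.ubar_le_add {p : ℝ × ℝ → ℝ} (hp : IsPriceSchedule p) {s t : ℝ}
    (h : s ≤ t) : ubar p t ≤ ubar p s + (t - s) := by
  simpa [ubar] using hp.utility_le_add (x := (s, 1)) (y := (t, 1)) h le_rfl

lemma IsPriceSchedule.continuous_ubar {p : ℝ × ℝ → ℝ} (hp : IsPriceSchedule p) :
    Continuous (ubar p) :=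
  hp.lipschitzWith_utility.continuous.comp (by fun_prop)

/-! ### Boundary layers of the square and radial regularity of the density -/

section

open Filter Topology intervalIntegral

lemma tendsto_average_left {d : ℝ → ℝ} (hd : Continuous d) :
    Tendsto (fun l : ℝ => (1 - l)⁻¹ * ∫ s in l..1, d s) (𝓝[<] 1) (𝓝 (d 1)) := by
  have h := (integral_hasDerivAt_right (hd.intervalIntegrable 0 1)
    (hd.stronglyMeasurableAtFilter _ _) hd.continuousAt).tendsto_slope
  have h' := h.mono_left (nhdsWithin_mono 1 (fun x (hx : x < 1) => ne_of_lt hx))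
  refine h'.congr' ?_
  filter_upwards [self_mem_nhdsWithin] with l hl
  have hl' : l - 1 ≠ 0 := by have : l < 1 := hl; linarith
  have hl'' : 1 - l ≠ 0 := by have : l < 1 := hl; linarith
  rw [slope_def_field,
    ← integral_add_adjacent_intervals (hd.intervalIntegrable 0 l) (hd.intervalIntegrable l 1)]
  field_simp
  ring

lemma setIntegral_square_eq {W : ℝ × ℝ → ℝ} (hW : Continuous W) {l : ℝ} (hl : 0 ≤ l) :
    ∫ x in Icc 0 l ×ˢ Icc 0 l, W x = ∫ t in (0 : ℝ)..l, ∫ s in (0 : ℝ)..l, W (t, s) := by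
  rw [Measure.volume_eq_prod, setIntegral_prod]
  · simp only [integral_Icc_eq_integral_Ioc, integral_of_le hl]
  · rw [← Measure.volume_eq_prod]
    exact hW.continuousOn.integrableOn_compact (isCompact_Icc.prod isCompact_Icc)

/-- The layer consists of two strips of width `1 - l`, each averaging to an edge integral; the
doubly counted corner has area `(1 - l) ^ 2` and drops out. -/
lemma tendsto_boundary_layer {W : ℝ × ℝ → ℝ} (hW : Continuous W) :
    Tendsto (fun l : ℝ => (1 - l)⁻¹ *
      ((∫ x in square, W x) - ∫ x in Icc 0 l ×ˢ Icc 0 l, W x)) (𝓝[<] 1)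
      (𝓝 ((∫ t in (0 : ℝ)..1, W (t, 1)) + ∫ t in (0 : ℝ)..1, W (1, t))) := by
  set d : ℝ → ℝ := fun s => ∫ t in (0 : ℝ)..1, W (t, s) with hd_def
  set e : ℝ → ℝ := fun t => ∫ s in (0 : ℝ)..1, W (t, s) with he_def
  have hd : Continuous d :=
    continuous_parametric_intervalIntegral_of_continuous' (f := fun s t => W (t, s))
      (by fun_prop) 0 1
  have he : Continuous e :=
    continuous_parametric_intervalIntegral_of_continuous' (f := fun t s => W (t, s))
      (by fun_prop) 0 1
  have hin : ∀ a b : ℝ, Continuous fun t => ∫ s in a..b, W (t, s) := fun a b =>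
    continuous_parametric_intervalIntegral_of_continuous' (f := fun t s => W (t, s))
      (by fun_prop) a b
  have hWt : ∀ t : ℝ, Continuous fun s => W (t, s) := fun t => by fun_prop
  obtain ⟨C, hC⟩ := (isCompact_Icc.prod isCompact_Icc : IsCompact (square)).exists_bound_of_continuousOn
    hW.continuousOn
  have hsmall : Tendsto (fun l : ℝ => (1 - l)⁻¹ * ∫ t in l..1, ∫ s in l..1, W (t, s))
      (𝓝[<] 1) (𝓝 0) := by
    have hz : Tendsto (fun l : ℝ => C * (1 - l)) (𝓝[<] 1) (𝓝 0) := by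
      have : Tendsto (fun l : ℝ => C * (1 - l)) (𝓝 1) (𝓝 (C * (1 - 1))) :=
        (by fun_prop : Continuous fun l : ℝ => C * (1 - l)).tendsto 1
      simp only [sub_self, mul_zero] at this
      exact this.mono_left nhdsWithin_le_nhds
    refine squeeze_zero_norm' ?_ hz
    filter_upwards [Ioo_mem_nhdsLT (show (0 : ℝ) < 1 by norm_num)] with l hl
    have hl1 : 0 < 1 - l := by linarith [hl.2]
    have hb : ∀ t ∈ uIoc l 1, ‖∫ s in l..1, W (t, s)‖ ≤ C * |1 - l| := by
      intro t ht
      refine norm_integral_le_of_norm_le_const fun s hs => ?_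
      rw [uIoc_of_le hl.2.le] at ht hs
      exact hC (t, s) (mem_square.2 ⟨⟨by linarith [hl.1, ht.1], ht.2⟩,
        by linarith [hl.1, hs.1], hs.2⟩)
    have := norm_integral_le_of_norm_le_const hb
    rw [norm_mul, norm_inv, Real.norm_of_nonneg hl1.le]
    rw [abs_of_pos hl1] at this
    calc (1 - l)⁻¹ * _ ≤ (1 - l)⁻¹ * (C * (1 - l) * (1 - l)) := by gcongr
      _ = C * (1 - l) := by field_simp
  have key := ((tendsto_average_left hd).add (tendsto_average_left he)).sub hsmall
  rw [sub_zero] at key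
  refine key.congr' ?_
  filter_upwards [Ioo_mem_nhdsLT (show (0 : ℝ) < 1 by norm_num)] with l hl
  rw [show square = Icc (0 : ℝ) 1 ×ˢ Icc (0 : ℝ) 1 from rfl,
    setIntegral_square_eq hW zero_le_one, setIntegral_square_eq hW hl.1.le,
    ← mul_add, ← mul_sub]
  congr 1
  have hswap : ∫ s in l..1, d s = ∫ t in (0 : ℝ)..1, ∫ s in l..1, W (t, s) := by
    simp only [hd_def]
    simp only [integral_of_le hl.2.le, integral_of_le zero_le_one]
    refine integral_integral_swap (f := fun s t => W (t, s)) ?_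
    rw [Measure.prod_restrict]
    have : Continuous (Function.uncurry fun s t : ℝ => W (t, s)) := by fun_prop
    exact (this.continuousOn.integrableOn_compact (μ := volume)
      (isCompact_Icc.prod isCompact_Icc)).mono_set
      (prod_mono Ioc_subset_Icc_self Ioc_subset_Icc_self)
  rw [hswap]
  have h1 : ∀ t, ∫ s in (0 : ℝ)..1, W (t, s)
      = (∫ s in (0 : ℝ)..l, W (t, s)) + ∫ s in l..1, W (t, s) := fun t =>
    (integral_add_adjacent_intervals ((hWt t).intervalIntegrable 0 l)
      ((hWt t).intervalIntegrable l 1)).symm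
  have h2 := integral_add_adjacent_intervals (μ := volume) (he.intervalIntegrable 0 l)
    (he.intervalIntegrable l 1)
  have h3 : ∫ t in (0 : ℝ)..l, e t = (∫ t in (0 : ℝ)..l, ∫ s in (0 : ℝ)..l, W (t, s))
      + ∫ t in (0 : ℝ)..l, ∫ s in l..1, W (t, s) := by
    rw [← integral_add ((hin _ _).intervalIntegrable _ _) ((hin _ _).intervalIntegrable _ _)]
    simp only [he_def, h1]
  have h4 := integral_add_adjacent_intervals (μ := volume) ((hin l 1).intervalIntegrable 0 l)
    ((hin l 1).intervalIntegrable l 1)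
  change _ = (∫ t in (0 : ℝ)..1, e t) - _
  linarith


lemma interior_square : interior square = Ioo (0 : ℝ) 1 ×ˢ Ioo (0 : ℝ) 1 := by
  rw [square, interior_prod_eq, interior_Icc]

lemma mem_interior_square {x : ℝ × ℝ} :
    x ∈ interior square ↔ (0 < x.1 ∧ x.1 < 1) ∧ 0 < x.2 ∧ x.2 < 1 := by
  rw [interior_square]; rfl

lemma isCompact_square : IsCompact square := isCompact_Icc.prod isCompact_Icc

lemma measurableSet_square : MeasurableSet square := isCompact_square.measurableSet

lemma restrict_square_eq :
    (volume : Measure (ℝ × ℝ)).restrict square = volume.restrict (interior square) := by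
  refine (Measure.restrict_congr_set ?_).symm
  rw [interior_square, square, Measure.volume_eq_prod]
  exact Measure.set_prod_ae_eq Ioo_ae_eq_Icc Ioo_ae_eq_Icc

lemma ae_restrict_square {P : ℝ × ℝ → Prop} (h : ∀ x ∈ interior square, P x) :
    ∀ᵐ x ∂(volume.restrict square), P x := by
  rw [restrict_square_eq]
  exact (ae_restrict_iff' isOpen_interior.measurableSet).2 (Eventually.of_forall h)

lemma smul_mem_interior_square {x : ℝ × ℝ} (hx : x ∈ interior square) {r : ℝ} (h0 : 0 < r)
    (h1 : r ≤ 1) : r • x ∈ interior square := by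
  rw [mem_interior_square] at *
  simp only [Prod.smul_fst, Prod.smul_snd, smul_eq_mul]
  refine ⟨⟨by nlinarith, by nlinarith⟩, by nlinarith, by nlinarith⟩

lemma norm_le_one_of_mem_square {x : ℝ × ℝ} (hx : x ∈ square) : ‖x‖ ≤ 1 := by
  rw [mem_square] at hx
  rw [Prod.norm_def, Real.norm_of_nonneg hx.1.1, Real.norm_of_nonneg hx.2.1]
  exact max_le hx.1.2 hx.2.2

namespace IsTypeDensity

variable {f : ℝ × ℝ → ℝ}

lemma differentiableAt (hf : IsTypeDensity f) {x : ℝ × ℝ} (hx : x ∈ interior square) :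
    DifferentiableAt ℝ f x :=
  (hf.contDiffOn.differentiableOn one_ne_zero).differentiableAt (isOpen_interior.mem_nhds hx)

lemma exists_bound (hf : IsTypeDensity f) : ∃ C : ℝ, 0 ≤ C ∧ ∀ x ∈ square, |f x| ≤ C := by
  obtain ⟨C, hC⟩ := isCompact_square.exists_bound_of_continuousOn hf.continuousOn
  exact ⟨max C 0, le_max_right _ _, fun x hx => (hC x hx).trans (le_max_left _ _)⟩

lemma hasDerivAt_radial (hf : IsTypeDensity f) {x : ℝ × ℝ} (hx : x ∈ interior square) {r : ℝ}
    (h0 : 0 < r) (h1 : r ≤ 1) :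
    HasDerivAt (fun r : ℝ => f (r • x)) (fderiv ℝ f (r • x) x) r := by
  have h := (hf.differentiableAt (smul_mem_interior_square hx h0 h1)).hasFDerivAt
  have h2 : HasDerivAt (fun r : ℝ => r • x) x r := by
    simpa using (hasDerivAt_id r).smul_const x
  exact h.comp_hasDerivAt r h2

/-- The gradient of `f` need not be bounded, but its radial part `x · ∇f = phi f - 3 f` is. The
factor `2` pays for `1 / r` with `r > 1 / 2`, since the derivative at `r • x` is taken in direction
`x`. -/
lemma exists_radial_bound (hf : IsTypeDensity f) : ∃ C : ℝ, 0 ≤ C ∧ ∀ x ∈ interior square,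
    ∀ l ∈ Ioo (1 / 2 : ℝ) 1, |f x - f (l • x)| ≤ C * (1 - l) := by
  obtain ⟨M, hM⟩ := hf.phi_bounded
  obtain ⟨C, hC0, hC⟩ := hf.exists_bound
  have hM0 : 0 ≤ M := (abs_nonneg _).trans (hM (1 / 2, 1 / 2) (by
    rw [mem_interior_square]; norm_num))
  refine ⟨2 * (M + 3 * C), by positivity, fun x hx l hl => ?_⟩
  have key := Convex.norm_image_sub_le_of_norm_hasDerivWithin_le (s := Icc l 1) (x := l) (y := 1)
    (f := fun r : ℝ => f (r • x)) (f' := fun r => fderiv ℝ f (r • x) x) (C := 2 * (M + 3 * C))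
    (fun r hr => (hf.hasDerivAt_radial hx (by linarith [hr.1, hl.1]) hr.2).hasDerivWithinAt)
    ?_ (convex_Icc _ _) ⟨le_rfl, hl.2.le⟩ ⟨hl.2.le, le_rfl⟩
  · simpa [Real.norm_eq_abs, abs_of_pos (sub_pos.2 hl.2)] using key
  · intro r hr
    have hr0 : 1 / 2 < r := hl.1.trans_le hr.1
    have hmem := smul_mem_interior_square hx (by linarith) hr.2
    have h1 := hM _ hmem
    have h2 := hC _ (interior_subset hmem)
    rw [phi, map_smul, smul_eq_mul] at h1
    rw [Real.norm_eq_abs, abs_le]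
    rw [abs_le] at h1 h2
    constructor <;> nlinarith

lemma aestronglyMeasurable (hf : IsTypeDensity f) :
    AEStronglyMeasurable f (volume.restrict square) :=
  hf.continuousOn.aestronglyMeasurable measurableSet_square

end IsTypeDensity

lemma measurable_fderiv_radial (ψ : ℝ × ℝ → ℝ) : Measurable fun x => fderiv ℝ ψ x x :=
  (ContinuousLinearMap.measurable_apply₂ (𝕜 := ℝ) (E := ℝ × ℝ) (F := ℝ)).comp
    ((measurable_fderiv ℝ ψ).prodMk measurable_id)

end

/-! ### Integration by parts along rays -/

section

open Filter Topology intervalIntegral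

/-- The retraction of the plane onto the unit square. -/
def clampSquare (x : ℝ × ℝ) : ℝ × ℝ := (max 0 (min 1 x.1), max 0 (min 1 x.2))

lemma continuous_clampSquare : Continuous clampSquare := by unfold clampSquare; fun_prop

lemma clampSquare_mem (x : ℝ × ℝ) : clampSquare x ∈ square := by
  simp [clampSquare, mem_square]

lemma clampSquare_of_mem {x : ℝ × ℝ} (hx : x ∈ square) : clampSquare x = x := by
  rw [mem_square] at hx
  ext <;> simp [clampSquare, hx]

lemma tendsto_boundary_layer_of_continuousOn {W : ℝ × ℝ → ℝ} (hW : ContinuousOn W square) :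
    Tendsto (fun l : ℝ => (1 - l)⁻¹ *
      ((∫ x in square, W x) - ∫ x in Icc 0 l ×ˢ Icc 0 l, W x)) (𝓝[<] 1)
      (𝓝 ((∫ t in (0 : ℝ)..1, W (t, 1)) + ∫ t in (0 : ℝ)..1, W (1, t))) := by
  have hc : Continuous fun x => W (clampSquare x) :=
    hW.comp_continuous continuous_clampSquare clampSquare_mem
  have h := tendsto_boundary_layer hc
  have e1 : ∫ t in (0 : ℝ)..1, W (clampSquare (t, 1)) = ∫ t in (0 : ℝ)..1, W (t, 1) :=
    integral_congr fun t ht => by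
      rw [uIcc_of_le zero_le_one] at ht
      simp only [clampSquare_of_mem (x := (t, 1)) (mem_square.2 ⟨ht, zero_le_one, le_rfl⟩)]
  have e2 : ∫ t in (0 : ℝ)..1, W (clampSquare (1, t)) = ∫ t in (0 : ℝ)..1, W (1, t) :=
    integral_congr fun t ht => by
      rw [uIcc_of_le zero_le_one] at ht
      simp only [clampSquare_of_mem (x := (1, t)) (mem_square.2 ⟨⟨zero_le_one, le_rfl⟩, ht⟩)]
  rw [e1, e2] at h
  refine h.congr' ?_
  filter_upwards [Ioo_mem_nhdsLT (show (0 : ℝ) < 1 by norm_num)] with l hl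
  congr 2
  · exact setIntegral_congr_fun measurableSet_square fun x hx => by
      simp only [clampSquare_of_mem hx]
  · exact setIntegral_congr_fun (measurableSet_Icc.prod measurableSet_Icc) fun x hx => by
      have : x ∈ square := prod_mono (Icc_subset_Icc_right hl.2.le)
        (Icc_subset_Icc_right hl.2.le) hx
      simp only [clampSquare_of_mem this]

open scoped Pointwise in
lemma smul_square {l : ℝ} (hl : 0 < l) :
    l • square = Icc (0 : ℝ) l ×ˢ Icc (0 : ℝ) l := by
  ext x
  rw [mem_smul_set_iff_inv_smul_mem₀ hl.ne', mem_square]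
  simp only [Prod.smul_fst, Prod.smul_snd, smul_eq_mul, mem_prod, mem_Icc,
    inv_mul_le_iff₀ hl, mul_one]
  have : ∀ y : ℝ, 0 ≤ l⁻¹ * y ↔ 0 ≤ y := fun y => by
    rw [mul_nonneg_iff_of_pos_left (inv_pos.2 hl)]
  rw [this, this]

instance : IsFiniteMeasure ((volume : Measure (ℝ × ℝ)).restrict square) :=
  isFiniteMeasure_restrict.2 isCompact_square.measure_lt_top.ne

lemma setIntegral_square_comp_smul (W : ℝ × ℝ → ℝ) {l : ℝ} (hl : 0 < l) :
    l ^ 2 * ∫ x in square, W (l • x) = ∫ x in Icc 0 l ×ˢ Icc 0 l, W x := by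
  rw [Measure.setIntegral_comp_smul_of_pos volume W square hl, smul_square hl]
  simp only [Module.finrank_prod, Module.finrank_self, smul_eq_mul]
  norm_num
  field_simp

namespace IsTypeDensity

variable {f : ℝ × ℝ → ℝ}

lemma aestronglyMeasurable_phi (hf : IsTypeDensity f) :
    AEStronglyMeasurable (phi f) (volume.restrict square) :=
  (measurable_fderiv_radial f).aestronglyMeasurable.add (hf.aestronglyMeasurable.const_mul 3)

lemma integrableOn_mul_phi (hf : IsTypeDensity f) {ψ : ℝ × ℝ → ℝ} (hψ : ContinuousOn ψ square) :
    IntegrableOn (fun x => ψ x * phi f x) square := by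
  obtain ⟨M, hM⟩ := hf.phi_bounded
  obtain ⟨C, hC⟩ := isCompact_square.exists_bound_of_continuousOn hψ
  refine Integrable.of_bound
    ((hψ.aestronglyMeasurable measurableSet_square).mul hf.aestronglyMeasurable_phi) (C * M)
    (ae_restrict_square fun x hx => ?_)
  rw [norm_mul]
  exact mul_le_mul (hC x (interior_subset hx)) (hM x hx) (norm_nonneg _)
    ((norm_nonneg _).trans (hC x (interior_subset hx)))

/-- Integration by parts along rays. -/
theorem integral_radial (hf : IsTypeDensity f) {ψ : ℝ × ℝ → ℝ} {K : NNReal}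
    (hψ : LipschitzOnWith K ψ square) :
    ∫ x in square, (fderiv ℝ ψ x x - ψ x) * f x =
      (∫ t in (0 : ℝ)..1, ψ (t, 1) * f (t, 1)) + (∫ t in (0 : ℝ)..1, ψ (1, t) * f (1, t))
        - ∫ x in square, ψ x * phi f x := by
  obtain ⟨Cf, hCf0, hCf⟩ := hf.exists_bound
  obtain ⟨Cr, hCr0, hCr⟩ := hf.exists_radial_bound
  obtain ⟨Cψ', hCψ'⟩ := isCompact_square.exists_bound_of_continuousOn hψ.continuousOn
  obtain ⟨Cψ, hCψ0, hCψ⟩ : ∃ C : ℝ, 0 ≤ C ∧ ∀ x ∈ square, |ψ x| ≤ C :=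
    ⟨max Cψ' 0, le_max_right _ _, fun x hx => (hCψ' x hx).trans (le_max_left _ _)⟩
  set W : ℝ × ℝ → ℝ := fun x => ψ x * f x with hW
  have hWc : ContinuousOn W square := hψ.continuousOn.mul hf.continuousOn
  have hWi : IntegrableOn W square := hWc.integrableOn_compact isCompact_square
  have hmeas : AEStronglyMeasurable (fun x => (fderiv ℝ ψ x x - ψ x) * f x)
      (volume.restrict square) :=
    ((measurable_fderiv_radial ψ).aestronglyMeasurable.sub
      (hψ.continuousOn.aestronglyMeasurable measurableSet_square)).mul hf.aestronglyMeasurable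
  have hint : IntegrableOn (fun x => (fderiv ℝ ψ x x - ψ x) * f x) square := by
    refine Integrable.of_bound hmeas ((K + Cψ) * Cf) (ae_restrict_square fun x hx => ?_)
    have hxs := interior_subset hx
    have h1 : ‖fderiv ℝ ψ x x‖ ≤ K := by
      calc ‖fderiv ℝ ψ x x‖ ≤ ‖fderiv ℝ ψ x‖ * ‖x‖ := ContinuousLinearMap.le_opNorm _ _
        _ ≤ K * 1 := mul_le_mul
            (norm_fderiv_le_of_lipschitzOn ℝ (mem_interior_iff_mem_nhds.1 hx) hψ)
            (norm_le_one_of_mem_square hxs) (norm_nonneg _) K.2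
        _ = K := mul_one _
    rw [norm_mul]
    exact mul_le_mul ((norm_sub_le _ _).trans (add_le_add h1 (hCψ x hxs))) (hCf x hxs)
      (norm_nonneg _) (by positivity)
  have hφi := hf.integrableOn_mul_phi hψ.continuousOn
  have hdiff : ∀ᵐ x ∂(volume.restrict square), DifferentiableWithinAt ℝ ψ square x :=
    hψ.ae_differentiableWithinAt measurableSet_square
  -- The same difference quotient is evaluated in two ways. Pointwise almost everywhere (Rademacher)
  -- it tends to the derivative of `r ^ 2 * W (r • x)` at `r = 1`; the power `2` together with the
  -- `-ψ` split off yields the `3` in `phi`.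
  have hlim : Tendsto (fun l : ℝ => ∫ x in square, (1 - l)⁻¹ * (W x - l ^ 2 * W (l • x)))
      (𝓝[<] 1) (𝓝 (∫ x in square, ((fderiv ℝ ψ x x - ψ x) * f x + ψ x * phi f x))) := by
    refine tendsto_integral_filter_of_dominated_convergence
      (fun _ => (K * Cf + Cψ * Cr) + 2 * (Cψ * Cf)) ?_ ?_
      (integrableOn_const isCompact_square.measure_lt_top.ne) ?_
    · filter_upwards [Ioo_mem_nhdsLT (show (0 : ℝ) < 1 by norm_num)] with l hl
      refine ((hWi.aestronglyMeasurable).sub (ContinuousOn.aestronglyMeasurable ?_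
        measurableSet_square)).const_mul _
      refine continuousOn_const.mul (hWc.comp (by fun_prop) fun x hx => ?_)
      rw [mem_square] at *
      simp only [Prod.smul_fst, Prod.smul_snd, smul_eq_mul]
      refine ⟨⟨?_, ?_⟩, ?_, ?_⟩ <;> nlinarith [hl.1, hl.2]
    · filter_upwards [Ioo_mem_nhdsLT (show (1 / 2 : ℝ) < 1 by norm_num)] with l hl
      refine ae_restrict_square fun x hx => ?_
      have hl1 : 0 < 1 - l := by linarith [hl.2]
      have hl0 : 0 < l := by linarith [hl.1]
      have hlx := interior_subset (smul_mem_interior_square hx hl0 hl.2.le)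
      have hxs := interior_subset hx
      have hd1 : |ψ x - ψ (l • x)| ≤ K * (1 - l) := by
        refine (hψ.norm_sub_le hxs hlx).trans (mul_le_mul_of_nonneg_left ?_ K.2)
        have : x - l • x = (1 - l) • x := by rw [sub_smul, one_smul]
        rw [this, norm_smul, Real.norm_of_nonneg hl1.le]
        exact mul_le_of_le_one_right hl1.le (norm_le_one_of_mem_square hxs)
      have hd2 := hCr x hx l hl
      have e : W x - l ^ 2 * W (l • x) = (ψ x - ψ (l • x)) * f x + ψ (l • x) * (f x - f (l • x))
          + (1 - l) * ((1 + l) * (ψ (l • x) * f (l • x))) := by simp only [hW]; ring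
      rw [norm_mul, norm_inv, Real.norm_of_nonneg hl1.le, inv_mul_le_iff₀ hl1, e]
      have b1 : ‖(ψ x - ψ (l • x)) * f x‖ ≤ K * (1 - l) * Cf := by
        rw [norm_mul]; exact mul_le_mul hd1 (hCf x hxs) (norm_nonneg _) (by positivity)
      have b2 : ‖ψ (l • x) * (f x - f (l • x))‖ ≤ Cψ * (Cr * (1 - l)) := by
        rw [norm_mul]; exact mul_le_mul (hCψ _ hlx) hd2 (norm_nonneg _) (by positivity)
      have b3 : ‖(1 - l) * ((1 + l) * (ψ (l • x) * f (l • x)))‖ ≤ (1 - l) * (2 * (Cψ * Cf)) := by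
        rw [norm_mul, norm_mul, norm_mul, Real.norm_of_nonneg hl1.le,
          Real.norm_of_nonneg (by linarith : 0 ≤ 1 + l)]
        gcongr
        · linarith [hl.2]
        · exact hCψ _ hlx
        · exact hCf _ hlx
      calc _ ≤ _ := norm_add₃_le
        _ ≤ K * (1 - l) * Cf + Cψ * (Cr * (1 - l)) + (1 - l) * (2 * (Cψ * Cf)) := by gcongr
        _ = _ := by ring
    · have hae : ∀ᵐ x ∂(volume.restrict square), x ∈ interior square :=
        ae_restrict_square fun x hx => hx
      filter_upwards [hdiff, hae] with x hx hxi
      have hψd : DifferentiableAt ℝ ψ x := hx.differentiableAt (mem_interior_iff_mem_nhds.1 hxi)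
      have h2 : HasDerivAt (fun r : ℝ => r • x) x 1 := by
        simpa using (hasDerivAt_id (1 : ℝ)).smul_const x
      have hψr : HasDerivAt (fun r : ℝ => ψ (r • x)) (fderiv ℝ ψ x x) 1 := by
        have h := hψd.hasFDerivAt
        rw [← one_smul ℝ x] at h
        simpa [Function.comp_def] using h.comp_hasDerivAt (1 : ℝ) h2
      have hfr := hf.hasDerivAt_radial hxi one_pos le_rfl
      have hWr : HasDerivAt (fun r : ℝ => r ^ 2 * (ψ (r • x) * f (r • x)))
          ((fderiv ℝ ψ x x - ψ x) * f x + ψ x * phi f x) 1 := by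
        refine ((hasDerivAt_pow 2 (1 : ℝ)).fun_mul (hψr.fun_mul hfr)).congr_deriv ?_
        simp only [one_smul, phi]; push_cast; ring
      have hWr := hWr.tendsto_slope.mono_left
        (nhdsWithin_mono 1 (fun x (hx : x < 1) => ne_of_lt hx))
      refine hWr.congr' ?_
      filter_upwards [self_mem_nhdsWithin] with l hl
      have hl' : l - 1 ≠ 0 := by have : l < 1 := hl; linarith
      have hl'' : 1 - l ≠ 0 := by have : l < 1 := hl; linarith
      rw [slope_def_field]
      simp only [one_smul, hW]
      field_simp
      ring
  -- Here `l ^ 2` is the Jacobian of `x ↦ l • x`, so the quotient is a boundary layer integral.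
  have hlim2 : Tendsto (fun l : ℝ => ∫ x in square, (1 - l)⁻¹ * (W x - l ^ 2 * W (l • x)))
      (𝓝[<] 1) (𝓝 ((∫ t in (0 : ℝ)..1, W (t, 1)) + ∫ t in (0 : ℝ)..1, W (1, t))) := by
    refine (tendsto_boundary_layer_of_continuousOn hWc).congr' ?_
    filter_upwards [Ioo_mem_nhdsLT (show (0 : ℝ) < 1 by norm_num)] with l hl
    rw [MeasureTheory.integral_const_mul, MeasureTheory.integral_sub hWi,
      MeasureTheory.integral_const_mul, setIntegral_square_comp_smul W hl.1]
    refine (ContinuousOn.integrableOn_compact isCompact_square ?_)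
    refine continuousOn_const.mul (hWc.comp (by fun_prop) fun x hx => ?_)
    rw [mem_square] at *
    simp only [Prod.smul_fst, Prod.smul_snd, smul_eq_mul]
    refine ⟨⟨?_, ?_⟩, ?_, ?_⟩ <;> nlinarith [hl.1, hl.2]
  have h := tendsto_nhds_unique hlim hlim2
  rw [MeasureTheory.integral_add hint hφi] at h
  linarith

end IsTypeDensity

end

/-! ### Symmetry: reduction to the triangle above the diagonal -/

section

open Filter Topology intervalIntegral

lemma swap_mem_interior_square {x : ℝ × ℝ} (hx : x ∈ interior square) :
    x.swap ∈ interior square := by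
  rw [mem_interior_square] at *
  exact ⟨hx.2, hx.1⟩

lemma IsSRS.swap_eq {f : ℝ × ℝ → ℝ} (hf : IsSRS f) {x : ℝ × ℝ} (hx : x ∈ square) :
    f x.swap = f x :=
  (hf.symmetric x.1 hx.1 x.2 hx.2).symm

/-- The radial derivative depends only on `r ↦ f (r • x)` near `r = 1`, where the rays through `x`
and `x.swap` carry the same values. -/
lemma IsSRS.phi_swap {f : ℝ × ℝ → ℝ} (hf : IsSRS f) {x : ℝ × ℝ} (hx : x ∈ interior square) :
    phi f x.swap = phi f x := by
  have h1 := hf.hasDerivAt_radial hx one_pos le_rfl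
  have h2 := hf.hasDerivAt_radial (swap_mem_interior_square hx) one_pos le_rfl
  have hev : (fun r : ℝ => f (r • x.swap)) =ᶠ[𝓝 1] fun r => f (r • x) := by
    have hc : ContinuousAt (fun r : ℝ => r • x) 1 := by fun_prop
    have := hc.preimage_mem_nhds (isOpen_interior.mem_nhds (by simpa using hx))
    filter_upwards [this] with r hr
    exact hf.swap_eq (x := r • x) (interior_subset hr)
  have h3 := h1.unique (h2.congr_of_eventuallyEq hev.symm)
  simp only [one_smul] at h3
  rw [phi, phi, h3, hf.swap_eq (interior_subset hx)]

section Triangle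

variable {k : ℝ × ℝ → ℝ}

lemma integrableOn_interior (hk : IntegrableOn k square) :
    Integrable k ((volume.restrict (Ioo (0 : ℝ) 1)).prod (volume.restrict (Ioo (0 : ℝ) 1))) := by
  rw [Measure.prod_restrict, ← Measure.volume_eq_prod, ← interior_square]
  exact hk.mono_set interior_subset

lemma integral_slice_lt {t : ℝ} (ht : t ∈ Ioo (0 : ℝ) 1) :
    ∫ s in Ioo (0 : ℝ) 1, {x : ℝ × ℝ | x.1 < x.2}.indicator k (t, s)
      = ∫ s in t..1, k (t, s) := by
  have : (fun s => {x : ℝ × ℝ | x.1 < x.2}.indicator k (t, s))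
      = (Ioi t).indicator fun s => k (t, s) := by
    ext s; simp [indicator]
  rw [this, setIntegral_indicator measurableSet_Ioi, integral_of_le ht.2.le,
    integral_Ioc_eq_integral_Ioo]
  congr 2
  ext s
  simp only [mem_inter_iff, mem_Ioo, mem_Ioi]
  exact ⟨fun h => ⟨h.2, h.1.2⟩, fun h => ⟨⟨ht.1.trans h.1, h.2⟩, h.1⟩⟩

lemma integral_slice_le {t : ℝ} (ht : t ∈ Ioo (0 : ℝ) 1) :
    ∫ s in Ioo (0 : ℝ) 1, {x : ℝ × ℝ | x.1 ≤ x.2}.indicator k (t, s)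
      = ∫ s in t..1, k (t, s) := by
  have : (fun s => {x : ℝ × ℝ | x.1 ≤ x.2}.indicator k (t, s))
      = (Ici t).indicator fun s => k (t, s) := by
    ext s; simp [indicator]
  rw [this, setIntegral_indicator measurableSet_Ici, integral_of_le ht.2.le,
    integral_Ioc_eq_integral_Ioo, ← integral_Ico_eq_integral_Ioo]
  congr 2
  ext s
  simp only [mem_inter_iff, mem_Ioo, mem_Ici, mem_Ico]
  exact ⟨fun h => ⟨h.2, h.1.2⟩, fun h => ⟨⟨ht.1.trans_le h.1, h.2⟩, h.1⟩⟩

lemma intervalIntegrable_slice (hk : IntegrableOn k square) :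
    IntervalIntegrable (fun t => ∫ s in t..1, k (t, s)) volume 0 1 := by
  rw [intervalIntegrable_iff_integrableOn_Ioo_of_le zero_le_one]
  have h := ((integrableOn_interior hk).indicator
    (measurableSet_lt measurable_fst measurable_snd)).integral_prod_left
  refine h.congr ?_
  exact (ae_restrict_iff' measurableSet_Ioo).2 (Eventually.of_forall fun t ht =>
    integral_slice_lt ht)

/-- The swap carries the complement of the strict upper triangle to the closed upper triangle. Both
triangles have the same slice integrals, as the diagonal meets each slice in one point. -/
lemma setIntegral_square_of_symm (hk : IntegrableOn k square)
    (hs : ∀ x ∈ interior square, k x.swap = k x) :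
    ∫ x in square, k x = 2 * ∫ t in (0 : ℝ)..1, ∫ s in t..1, k (t, s) := by
  have hlt : MeasurableSet {x : ℝ × ℝ | x.1 < x.2} := measurableSet_lt measurable_fst measurable_snd
  have hle : MeasurableSet {x : ℝ × ℝ | x.1 ≤ x.2} := measurableSet_le measurable_fst measurable_snd
  have hki := integrableOn_interior hk
  have key : ∀ s : Set (ℝ × ℝ), MeasurableSet s →
      (∀ t ∈ Ioo (0 : ℝ) 1, ∫ r in Ioo (0 : ℝ) 1, s.indicator k (t, r) = ∫ r in t..1, k (t, r)) →
      ∫ x in interior square ∩ s, k x = ∫ t in (0 : ℝ)..1, ∫ r in t..1, k (t, r) := by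
    intro s hs h
    rw [← setIntegral_indicator hs, interior_square, Measure.volume_eq_prod,
      ← Measure.prod_restrict, integral_prod _ (hki.indicator hs), integral_of_le zero_le_one,
      integral_Ioc_eq_integral_Ioo]
    exact setIntegral_congr_fun measurableSet_Ioo h
  have h1 := key _ hlt fun t ht => integral_slice_lt ht
  have h2 := key _ hle fun t ht => integral_slice_le ht
  have h3 : ∫ x in interior square \ {x : ℝ × ℝ | x.1 < x.2}, k x
      = ∫ x in interior square ∩ {x : ℝ × ℝ | x.1 ≤ x.2}, k x := by
    have hmp : MeasurePreserving (Prod.swap : ℝ × ℝ → ℝ × ℝ) volume volume :=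
      Measure.measurePreserving_swap
    rw [← hmp.setIntegral_preimage_emb MeasurableEquiv.prodComm.measurableEmbedding k
      (interior square ∩ {x : ℝ × ℝ | x.1 ≤ x.2})]
    have : Prod.swap ⁻¹' (interior square ∩ {x : ℝ × ℝ | x.1 ≤ x.2})
        = interior square \ {x : ℝ × ℝ | x.1 < x.2} := by
      ext x
      simp only [mem_preimage, mem_inter_iff, mem_interior_square, mem_ofPred_eq, Set.mem_sdiff, not_lt,
        Prod.fst_swap, Prod.snd_swap]
      tauto
    rw [this]
    exact setIntegral_congr_fun (isOpen_interior.measurableSet.diff hlt)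
      fun x hx => (hs x hx.1).symm
  rw [restrict_square_eq, ← integral_inter_add_sdiff hlt (hk.mono_set interior_subset), h1, h3, h2]
  ring

end Triangle

/-- The contribution to revenue of the vertical segment above the diagonal at first coordinate `t`,
for an indirect utility `ψ`. -/
def sliceRevenue (f ψ : ℝ × ℝ → ℝ) (t : ℝ) : ℝ :=
  ψ (t, 1) * f (t, 1) - ∫ s in t..1, ψ (t, s) * phi f (t, s)

lemma continuousOn_top {ψ : ℝ × ℝ → ℝ} (hψ : ContinuousOn ψ square) :
    ContinuousOn (fun t : ℝ => ψ (t, 1)) (Icc 0 1) :=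
  hψ.comp (by fun_prop) fun t ht => mem_square.2 ⟨ht, zero_le_one, le_rfl⟩

lemma IsTypeDensity.intervalIntegrable_sliceRevenue {f : ℝ × ℝ → ℝ} (hf : IsTypeDensity f)
    {ψ : ℝ × ℝ → ℝ} (hψ : ContinuousOn ψ square) :
    IntervalIntegrable (sliceRevenue f ψ) volume 0 1 := by
  refine IntervalIntegrable.sub (ContinuousOn.intervalIntegrable ?_)
    (intervalIntegrable_slice (hf.integrableOn_mul_phi hψ))
  rw [uIcc_of_le zero_le_one]
  exact (continuousOn_top hψ).mul (continuousOn_top hf.continuousOn)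

theorem IsSRS.integral_radial_of_symm {f : ℝ × ℝ → ℝ} (hf : IsSRS f) {ψ : ℝ × ℝ → ℝ} {K : NNReal}
    (hψ : LipschitzOnWith K ψ square) (hs : ∀ x ∈ square, ψ x.swap = ψ x) :
    ∫ x in square, (fderiv ℝ ψ x x - ψ x) * f x = 2 * ∫ t in (0 : ℝ)..1, sliceRevenue f ψ t := by
  have hi := hf.integrableOn_mul_phi hψ.continuousOn
  have htop : IntervalIntegrable (fun t : ℝ => ψ (t, 1) * f (t, 1)) volume 0 1 := by
    refine ContinuousOn.intervalIntegrable ?_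
    rw [uIcc_of_le zero_le_one]
    exact (continuousOn_top hψ.continuousOn).mul (continuousOn_top hf.continuousOn)
  have hedge : ∫ t in (0 : ℝ)..1, ψ (1, t) * f (1, t)
      = ∫ t in (0 : ℝ)..1, ψ (t, 1) * f (t, 1) := by
    refine integral_congr fun t ht => ?_
    rw [uIcc_of_le zero_le_one] at ht
    have hm : (t, (1 : ℝ)) ∈ square := mem_square.2 ⟨ht, zero_le_one, le_rfl⟩
    have e1 := hs _ hm
    have e2 := hf.swap_eq hm
    simp only [Prod.swap_prod_mk] at e1 e2
    simp only [e1, e2]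
  rw [hf.integral_radial hψ, hedge, setIntegral_square_of_symm hi]
  · simp only [sliceRevenue]
    rw [intervalIntegral.integral_sub htop (intervalIntegrable_slice hi)]
    ring
  · intro x hx
    rw [hs x (interior_subset hx), hf.phi_swap hx]

end

/-! ### The one-dimensional problem on a vertical segment -/

section

open Filter Topology intervalIntegral

/-- The last point of the unit interval at which the upper tail integral of `h` is at least `c`. -/
def tailThreshold (h : ℝ → ℝ) (c : ℝ) : ℝ :=
  sSup {z : ℝ | z ∈ Icc (0 : ℝ) 1 ∧ 0 ≤ (∫ s in z..1, h s) - c}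

/-- The revenue from a vertical segment starting at height `t` when the indirect utility at its
upper end is `y` and decreases with slope one below that, as long as it is positive. -/
def segmentRevenue (h : ℝ → ℝ) (c t y : ℝ) : ℝ :=
  y * c - ∫ s in t..1, max 0 (y + s - 1) * h s

lemma bddAbove_tail (h : ℝ → ℝ) (c : ℝ) :
    BddAbove {z : ℝ | z ∈ Icc (0 : ℝ) 1 ∧ 0 ≤ (∫ s in z..1, h s) - c} :=
  ⟨1, fun _ hz => hz.1.2⟩

lemma tailThreshold_nonneg (h : ℝ → ℝ) (c : ℝ) : 0 ≤ tailThreshold h c :=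
  Real.sSup_nonneg fun _ hz => hz.1.1

lemma tailThreshold_le_one (h : ℝ → ℝ) (c : ℝ) : tailThreshold h c ≤ 1 :=
  Real.sSup_le (fun _ hz => hz.1.2) zero_le_one

/-- A positive integrable profile on the unit interval together with a positive target. -/
structure IsPositiveProfile (h : ℝ → ℝ) (c : ℝ) : Prop where
  integrable : IntervalIntegrable h volume 0 1
  pos : ∀ᵐ s ∂(volume.restrict (Ioo (0 : ℝ) 1)), 0 < h s
  target_pos : 0 < c

namespace IsPositiveProfile

variable {h : ℝ → ℝ} {c : ℝ}

lemma integrable_sub (H : IsPositiveProfile h c) {a b : ℝ} (ha : a ∈ Icc (0 : ℝ) 1)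
    (hb : b ∈ Icc (0 : ℝ) 1) : IntervalIntegrable h volume a b := by
  refine H.integrable.mono_set ?_
  rw [uIcc_of_le zero_le_one]
  exact uIcc_subset_Icc ha hb

lemma ae_pos (H : IsPositiveProfile h c) {a b : ℝ} (ha : 0 ≤ a) (hb : b ≤ 1) :
    ∀ᵐ s ∂(volume.restrict (Ioc a b)), 0 < h s := by
  rw [Measure.restrict_congr_set Ioo_ae_eq_Ioc.symm]
  exact ae_mono (Measure.restrict_mono (Ioo_subset_Ioo ha hb) le_rfl) H.pos

lemma integral_pos (H : IsPositiveProfile h c) {a b : ℝ} (ha : 0 ≤ a) (hab : a < b) (hb : b ≤ 1) :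
    0 < ∫ s in a..b, h s := by
  have hi := H.integrable_sub (a := a) (b := b) ⟨ha, by linarith⟩ ⟨by linarith, hb⟩
  have hp := H.ae_pos ha hb
  rw [integral_pos_iff_support_of_nonneg_ae' (by
    rw [uIoc_of_le hab.le]; filter_upwards [hp] with s hs using hs.le) hi]
  refine ⟨hab, ?_⟩
  have : Ioc a b ≤ᵐ[volume] (Function.support h ∩ Ioc a b : Set ℝ) := by
    have := (ae_restrict_iff' measurableSet_Ioc).1 hp
    filter_upwards [this] with s hs hsab
    exact ⟨(hs hsab).ne', hsab⟩
  refine lt_of_lt_of_le ?_ (measure_mono_ae this)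
  simp [hab]

lemma tail_strictAnti (H : IsPositiveProfile h c) {a b : ℝ} (ha : 0 ≤ a) (hab : a < b)
    (hb : b ≤ 1) : ∫ s in b..1, h s < ∫ s in a..1, h s := by
  rw [← integral_add_adjacent_intervals
    (H.integrable_sub (a := a) (b := b) ⟨ha, by linarith⟩ ⟨by linarith, hb⟩)
    (H.integrable_sub (a := b) (b := 1) ⟨by linarith, hb⟩ ⟨zero_le_one, le_rfl⟩)]
  linarith [H.integral_pos ha hab hb]

lemma tail_anti (H : IsPositiveProfile h c) {a b : ℝ} (ha : 0 ≤ a) (hab : a ≤ b)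
    (hb : b ≤ 1) : ∫ s in b..1, h s ≤ ∫ s in a..1, h s := by
  rcases hab.eq_or_lt with rfl | hab
  · exact le_rfl
  · exact (H.tail_strictAnti ha hab hb).le

lemma continuousOn_tail (H : IsPositiveProfile h c) :
    ContinuousOn (fun z => ∫ s in z..1, h s) (Icc 0 1) := by
  have := continuousOn_primitive_interval_left (μ := volume) (f := h) (a := 0) (b := 1) (by
    rw [uIcc_of_le zero_le_one]
    exact (intervalIntegrable_iff_integrableOn_Icc_of_le zero_le_one).1 H.integrable)
  rwa [uIcc_of_le zero_le_one] at this

lemma tail_lt_of_threshold_lt {z : ℝ} (hz0 : tailThreshold h c < z)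
    (hz1 : z ≤ 1) : ∫ s in z..1, h s < c := by
  by_contra! hcon
  have : z ≤ tailThreshold h c := le_csSup (bddAbove_tail h c)
    ⟨⟨(tailThreshold_nonneg h c).trans hz0.le, hz1⟩, sub_nonneg.2 hcon⟩
  linarith

lemma lt_tail_of_lt_threshold (H : IsPositiveProfile h c) {z : ℝ} (hz : 0 ≤ z)
    (hz0 : z < tailThreshold h c) : c < ∫ s in z..1, h s := by
  have hne : {z : ℝ | z ∈ Icc (0 : ℝ) 1 ∧ 0 ≤ (∫ s in z..1, h s) - c}.Nonempty := by
    by_contra hcon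
    rw [not_nonempty_iff_eq_empty] at hcon
    rw [tailThreshold, hcon, Real.sSup_empty] at hz0
    linarith
  obtain ⟨y, hy, hzy⟩ := exists_lt_of_lt_csSup hne hz0
  have := H.tail_strictAnti hz hzy hy.1.2
  linarith [hy.2]

/-- A limit from the left. Positivity of `z` matters: if no point qualifies, the threshold is the
default `0` and the inequality fails at `z = 0`. -/
lemma le_tail_of_le_threshold (H : IsPositiveProfile h c) {z : ℝ} (hz : 0 < z)
    (hz0 : z ≤ tailThreshold h c) : c ≤ ∫ s in z..1, h s := by
  have hz1 : z ≤ 1 := hz0.trans (tailThreshold_le_one h c)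
  have hc := (H.continuousOn_tail z ⟨hz.le, hz1⟩).mono_left
    (nhdsWithin_mono z (Ioo_subset_Icc_self.trans (Icc_subset_Icc_right hz1)) : 𝓝[Ioo 0 z] z ≤ _)
  have : (𝓝[Ioo 0 z] z).NeBot := by
    rw [nhdsWithin_Ioo_eq_nhdsLT hz]; infer_instance
  refine ge_of_tendsto hc ?_
  filter_upwards [self_mem_nhdsWithin] with y hy
  exact (H.lt_tail_of_lt_threshold hy.1.le (hy.2.trans_le hz0)).le

lemma threshold_lt_one (H : IsPositiveProfile h c) : tailThreshold h c < 1 := by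
  refine lt_of_le_of_ne (tailThreshold_le_one h c) fun h1 => ?_
  have := H.le_tail_of_le_threshold one_pos h1.ge
  rw [integral_same] at this
  linarith [H.target_pos]

lemma tail_threshold_le (H : IsPositiveProfile h c) :
    ∫ s in (tailThreshold h c)..1, h s ≤ c := by
  have h1 := H.threshold_lt_one
  have h0 := tailThreshold_nonneg h c
  have hc := (H.continuousOn_tail _ ⟨h0, h1.le⟩).mono_left
    (nhdsWithin_mono _ (Ioo_subset_Icc_self.trans (Icc_subset_Icc_left h0)) :
      𝓝[Ioo (tailThreshold h c) 1] (tailThreshold h c) ≤ _)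
  have : (𝓝[Ioo (tailThreshold h c) 1] (tailThreshold h c)).NeBot := by
    rw [nhdsWithin_Ioo_eq_nhdsGT h1]; infer_instance
  refine le_of_tendsto hc ?_
  filter_upwards [self_mem_nhdsWithin] with y hy
  exact (tail_lt_of_threshold_lt hy.1 hy.2.le).le

lemma integrable_mul (H : IsPositiveProfile h c) {k : ℝ → ℝ} (hk : Continuous k) {a b : ℝ}
    (ha : a ∈ Icc (0 : ℝ) 1) (hb : b ∈ Icc (0 : ℝ) 1) :
    IntervalIntegrable (fun s => k s * h s) volume a b :=
  (H.integrable_sub ha hb).continuousOn_mul hk.continuousOn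

lemma segmentRevenue_sub (H : IsPositiveProfile h c) {t m : ℝ} (ht : 0 ≤ t) (hm : m ≤ 1)
    (htm : t ≤ m) (y y' : ℝ) :
    segmentRevenue h c t y' - segmentRevenue h c t y = (y' - y) * c
      - ((∫ s in t..m, (max 0 (y' + s - 1) - max 0 (y + s - 1)) * h s)
        + ∫ s in m..1, (max 0 (y' + s - 1) - max 0 (y + s - 1)) * h s) := by
  have ht' : t ∈ Icc (0 : ℝ) 1 := ⟨ht, htm.trans hm⟩
  have hm' : m ∈ Icc (0 : ℝ) 1 := ⟨ht.trans htm, hm⟩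
  have h1 : (1 : ℝ) ∈ Icc (0 : ℝ) 1 := ⟨zero_le_one, le_rfl⟩
  rw [integral_add_adjacent_intervals (H.integrable_mul (by fun_prop) ht' hm')
    (H.integrable_mul (by fun_prop) hm' h1)]
  simp only [sub_mul]
  rw [intervalIntegral.integral_sub (H.integrable_mul (by fun_prop) ht' h1)
    (H.integrable_mul (by fun_prop) ht' h1)]
  simp only [segmentRevenue]
  ring

/-- In `y`, segment revenue is concave with slope `c - ∫ s in (max t (1 - y))..1, h s`. This bounds
an increment by the slope at the right end; `segmentRevenue_sub_le` uses the slope at the left end.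
-/
lemma le_segmentRevenue_sub (H : IsPositiveProfile h c) {t y y' : ℝ} (ht0 : 0 ≤ t) (ht1 : t ≤ 1)
    (hy : 0 ≤ y) (hyy : y ≤ y') :
    (y' - y) * (c - ∫ s in (max t (1 - y'))..1, h s)
      ≤ segmentRevenue h c t y' - segmentRevenue h c t y := by
  set m := max t (1 - y') with hm
  have hm1 : m ≤ 1 := max_le ht1 (by linarith)
  have htm : t ≤ m := le_max_left _ _
  rw [H.segmentRevenue_sub ht0 hm1 htm]
  have e1 : ∫ s in t..m, (max 0 (y' + s - 1) - max 0 (y + s - 1)) * h s = 0 := by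
    refine integral_zero_ae (Eventually.of_forall fun s hs => ?_)
    rw [uIoc_of_le htm] at hs
    have : s ≤ 1 - y' := by
      rcases le_total t (1 - y') with h | h
      · exact hs.2.trans_eq (max_eq_right h)
      · have : m = t := max_eq_left h
        linarith [hs.1, hs.2]
    rw [max_eq_left (by linarith), max_eq_left (by linarith)]
    simp
  have e2 : ∫ s in m..1, (max 0 (y' + s - 1) - max 0 (y + s - 1)) * h s
      ≤ ∫ s in m..1, (y' - y) * h s := by
    have hm' : m ∈ Icc (0 : ℝ) 1 := ⟨ht0.trans htm, hm1⟩
    have h1 : (1 : ℝ) ∈ Icc (0 : ℝ) 1 := ⟨zero_le_one, le_rfl⟩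
    rw [integral_of_le hm1, integral_of_le hm1]
    refine integral_mono_ae
      ((intervalIntegrable_iff_integrableOn_Ioc_of_le hm1).1 (H.integrable_mul (by fun_prop) hm' h1))
      ((intervalIntegrable_iff_integrableOn_Ioc_of_le hm1).1 (H.integrable_mul (by fun_prop) hm' h1))
      ?_
    filter_upwards [H.ae_pos hm'.1 le_rfl] with s hs
    refine mul_le_mul_of_nonneg_right ?_ hs.le
    rcases max_cases 0 (y' + s - 1) with h | h <;> rcases max_cases 0 (y + s - 1) with h' | h' <;>
      linarith
  rw [intervalIntegral.integral_const_mul] at e2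
  rw [e1]
  linarith

lemma segmentRevenue_sub_le (H : IsPositiveProfile h c) {t y y' : ℝ} (ht0 : 0 ≤ t) (ht1 : t ≤ 1)
    (hy : 0 ≤ y) (hyy : y ≤ y') :
    segmentRevenue h c t y' - segmentRevenue h c t y
      ≤ (y' - y) * (c - ∫ s in (max t (1 - y))..1, h s) := by
  set m := max t (1 - y) with hm
  have hm1 : m ≤ 1 := max_le ht1 (by linarith)
  have htm : t ≤ m := le_max_left _ _
  rw [H.segmentRevenue_sub ht0 hm1 htm]
  have e1 : 0 ≤ ∫ s in t..m, (max 0 (y' + s - 1) - max 0 (y + s - 1)) * h s := by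
    rw [integral_of_le htm]
    refine integral_nonneg_of_ae ?_
    filter_upwards [H.ae_pos ht0 hm1] with s hs
    refine mul_nonneg (sub_nonneg.2 (max_le_max le_rfl (by linarith))) hs.le
  have e2 : ∫ s in m..1, (max 0 (y' + s - 1) - max 0 (y + s - 1)) * h s
      = ∫ s in m..1, (y' - y) * h s := by
    refine integral_congr fun s hs => ?_
    rw [uIcc_of_le hm1] at hs
    have : 1 - y ≤ s := (le_max_right _ _).trans hs.1
    rw [max_eq_right (by linarith), max_eq_right (by linarith)]
    ring
  rw [intervalIntegral.integral_const_mul] at e2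
  rw [e2]
  linarith

lemma segmentRevenue_lt_of_threshold_lt (H : IsPositiveProfile h c) {t y y' : ℝ} (ht1 : t ≤ 1)
    (ht : tailThreshold h c < t) (hy : 0 ≤ y) (hyy : y < y') :
    segmentRevenue h c t y < segmentRevenue h c t y' := by
  have h1 := H.le_segmentRevenue_sub ((tailThreshold_nonneg h c).trans ht.le) ht1 hy hyy.le
  have h2 := tail_lt_of_threshold_lt (ht.trans_le (le_max_left t (1 - y')))
    (max_le ht1 (by linarith))
  nlinarith

lemma segmentRevenue_lt_of_le (H : IsPositiveProfile h c) {t y y' : ℝ} (ht0 : 0 ≤ t) (ht1 : t ≤ 1)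
    (hy : 0 ≤ y) (hyy : y < y') (hy' : y' ≤ 1 - tailThreshold h c) :
    segmentRevenue h c t y < segmentRevenue h c t y' := by
  -- The slope may vanish at `y'` itself, so strictness is obtained on the half up to the midpoint.
  have a1 := H.le_segmentRevenue_sub (y' := (y + y') / 2) ht0 ht1 hy (by linarith)
  have a2 := H.le_segmentRevenue_sub (y := (y + y') / 2) (y' := y') ht0 ht1 (by linarith)
    (by linarith)
  have b1 := tail_lt_of_threshold_lt (h := h) (c := c) (z := max t (1 - (y + y') / 2))
    (lt_of_lt_of_le (by linarith) (le_max_right _ _)) (max_le ht1 (by linarith))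
  have b2 := (H.tail_anti (tailThreshold_nonneg h c) (b := max t (1 - y'))
    (le_trans (by linarith) (le_max_right _ _)) (max_le ht1 (by linarith))).trans
    H.tail_threshold_le
  have c1 : 0 < ((y + y') / 2 - y) * (c - ∫ s in (max t (1 - (y + y') / 2))..1, h s) :=
    mul_pos (by linarith) (by linarith)
  have c2 : 0 ≤ (y' - (y + y') / 2) * (c - ∫ s in (max t (1 - y'))..1, h s) :=
    mul_nonneg (by linarith) (by linarith)
  linarith

lemma segmentRevenue_lt_of_ge (H : IsPositiveProfile h c) {t y y' : ℝ} (ht0 : 0 < t)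
    (ht : t < tailThreshold h c) (hyy : y < y') (hy : 1 - tailThreshold h c ≤ y) :
    segmentRevenue h c t y' < segmentRevenue h c t y := by
  have hz1 := tailThreshold_le_one h c
  have a1 := H.segmentRevenue_sub_le (y := y) (y' := (y + y') / 2) ht0.le (ht.le.trans hz1)
    (by linarith) (by linarith)
  have a2 := H.segmentRevenue_sub_le (y := (y + y') / 2) (y' := y') ht0.le (ht.le.trans hz1)
    (by linarith) (by linarith)
  have b1 := H.le_tail_of_le_threshold (z := max t (1 - y)) (lt_max_of_lt_left ht0)
    (max_le ht.le (by linarith))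
  have b2 := H.lt_tail_of_lt_threshold (z := max t (1 - (y + y') / 2)) (ht0.le.trans
    (le_max_left _ _)) (max_lt ht (by linarith))
  have c1 : ((y + y') / 2 - y) * (c - ∫ s in (max t (1 - y))..1, h s) ≤ 0 :=
    mul_nonpos_of_nonneg_of_nonpos (by linarith) (by linarith)
  have c2 : (y' - (y + y') / 2) * (c - ∫ s in (max t (1 - (y + y') / 2))..1, h s) < 0 :=
    mul_neg_of_pos_of_neg (by linarith) (by linarith)
  linarith

/-- Moving the utility at the upper end towards `1 - tailThreshold h c` raises revenue. -/
lemma segmentRevenue_lt_of_between (H : IsPositiveProfile h c) {t y w : ℝ} (ht0 : 0 < t)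
    (ht : t < tailThreshold h c) (hy : 0 ≤ y) (hne : y ≠ w)
    (h1 : min y (1 - tailThreshold h c) ≤ w) (h2 : w ≤ max y (1 - tailThreshold h c)) :
    segmentRevenue h c t y < segmentRevenue h c t w := by
  rcases lt_or_gt_of_ne hne with hlt | hlt
  · refine H.segmentRevenue_lt_of_le ht0.le (ht.le.trans (tailThreshold_le_one h c)) hy hlt ?_
    rcases le_max_iff.1 h2 with h | h
    · linarith
    · exact h
  · refine H.segmentRevenue_lt_of_ge ht0 ht hlt ?_
    rcases min_le_iff.1 h1 with h | h
    · linarith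
    · exact h

end IsPositiveProfile

end

/-! ### The threshold and its crossing of the diagonal -/

section

open Filter Topology intervalIntegral

/-- A line in the plane is null. -/
lemma volume_line {a b : ℝ} (hab : a ≠ 0 ∨ b ≠ 0) (c : ℝ) :
    volume {x : ℝ × ℝ | a * x.1 + b * x.2 = c} = 0 := by
  have hm : MeasurableSet {x : ℝ × ℝ | a * x.1 + b * x.2 = c} :=
    measurableSet_eq_fun (by fun_prop) (by fun_prop)
  rw [Measure.volume_eq_prod, Measure.measure_prod_null hm]
  by_cases hb : b = 0
  · have ha : a ≠ 0 := by tauto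
    have hne : ∀ᵐ t : ℝ, t ≠ c / a := by simp [ae_iff]
    filter_upwards [hne] with t ht
    have : Prod.mk t ⁻¹' {x : ℝ × ℝ | a * x.1 + b * x.2 = c} = ∅ := by
      ext s
      simp only [mem_preimage, mem_ofPred_eq, hb, zero_mul, add_zero, mem_empty_iff_false, iff_false]
      exact fun h => ht (by rw [eq_div_iff ha]; linarith)
    simp [this]
  · refine Eventually.of_forall fun t => ?_
    have : Prod.mk t ⁻¹' {x : ℝ × ℝ | a * x.1 + b * x.2 = c} ⊆ {(c - a * t) / b} := by
      intro s hs
      simp only [mem_preimage, mem_ofPred_eq] at hs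
      rw [mem_singleton_iff, eq_div_iff hb]
      linarith
    exact measure_mono_null this (by simp)

lemma IsSRS.ae_isPositiveProfile {f : ℝ × ℝ → ℝ} (hf : IsSRS f) :
    ∀ᵐ t ∂(volume.restrict (Ioo (0 : ℝ) 1)),
      IsPositiveProfile (fun s => phi f (t, s)) (f (t, 1)) := by
  have hi : IntegrableOn (phi f) square := by
    simpa using hf.integrableOn_mul_phi (ψ := fun _ => 1) continuousOn_const
  have h1 := (integrableOn_interior hi).prod_right_ae
  have hpos := hf.strictlyRegular
  rw [restrict_square_eq, interior_square, Measure.volume_eq_prod, ← Measure.prod_restrict] at hpos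
  have h2 := Measure.ae_ae_of_ae_prod hpos
  have h3 : ∀ᵐ t ∂(volume.restrict (Ioo (0 : ℝ) 1)), 0 < f (t, 1) ∧ 0 < f (1, t) :=
    ae_mono (Measure.restrict_mono Ioo_subset_Icc_self le_rfl) hf.pos_top
  filter_upwards [h1, h2, h3] with t h1 h2 h3
  exact ⟨(intervalIntegrable_iff_integrableOn_Ioo_of_le zero_le_one).2 h1, h2, h3.1⟩

/-- A test function for `IsSRS.exists_zeta_lt`: being homogeneous of degree two it is fixed by `ψ ↦
x · ∇ψ - ψ`, and above the diagonal it depends only on the first coordinate. -/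
lemma lipschitzOnWith_min_sq :
    LipschitzOnWith 2 (fun x : ℝ × ℝ => min x.1 x.2 ^ 2) square := by
  refine LipschitzOnWith.of_dist_le_mul fun x hx y hy => ?_
  rw [mem_square] at hx hy
  have h1 : |min x.1 x.2 - min y.1 y.2| ≤ dist x y := abs_min_sub_min_le_max _ _ _ _
  have h2 : |min x.1 x.2 + min y.1 y.2| ≤ 2 := by
    rw [abs_le]
    have := min_le_left x.1 x.2
    have := min_le_left y.1 y.2
    have := le_min hx.1.1 hx.2.1
    have := le_min hy.1.1 hy.2.1
    constructor <;> linarith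
  rw [Real.dist_eq, sq_sub_sq, abs_mul]
  exact mul_le_mul h2 h1 (abs_nonneg _) (by positivity)

lemma fderiv_min_sq {x : ℝ × ℝ} (hx : x.1 ≠ x.2) :
    fderiv ℝ (fun x : ℝ × ℝ => min x.1 x.2 ^ 2) x x = 2 * min x.1 x.2 ^ 2 := by
  have hd1 : HasFDerivAt (fun y : ℝ × ℝ => y.1 ^ 2)
      ((2 * x.1) • ContinuousLinearMap.fst ℝ ℝ ℝ) x := by
    simpa using (hasFDerivAt_fst (𝕜 := ℝ) (p := x)).pow 2
  have hd2 : HasFDerivAt (fun y : ℝ × ℝ => y.2 ^ 2)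
      ((2 * x.2) • ContinuousLinearMap.snd ℝ ℝ ℝ) x := by
    simpa using (hasFDerivAt_snd (𝕜 := ℝ) (p := x)).pow 2
  rcases lt_or_gt_of_ne hx with h | h
  · have hev : (fun y : ℝ × ℝ => min y.1 y.2 ^ 2) =ᶠ[𝓝 x] fun y => y.1 ^ 2 := by
      filter_upwards [(isOpen_lt continuous_fst continuous_snd).mem_nhds h] with y hy
      rw [min_eq_left (le_of_lt hy)]
    rw [hev.fderiv_eq, hd1.fderiv, min_eq_left h.le]
    simp; ring
  · have hev : (fun y : ℝ × ℝ => min y.1 y.2 ^ 2) =ᶠ[𝓝 x] fun y => y.2 ^ 2 := by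
      filter_upwards [(isOpen_lt continuous_snd continuous_fst).mem_nhds h] with y hy
      rw [min_eq_right (le_of_lt hy)]
    rw [hev.fderiv_eq, hd2.fderiv, min_eq_right h.le]
    simp; ring

/-- The threshold falls below the diagonal somewhere. -/
lemma IsSRS.exists_zeta_lt {f : ℝ × ℝ → ℝ} (hf : IsSRS f) :
    ∃ t ∈ Ioo (0 : ℝ) 1, zeta f t < t := by
  by_contra! hcon
  -- If `t ≤ zeta f t` throughout, each slice is `t ^ 2` times a nonpositive number, yet the total
  -- is the integral of `min x.1 x.2 ^ 2 * f x`. This forces `f = 0` almost everywhere.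
  have hrev := hf.integral_radial_of_symm lipschitzOnWith_min_sq
    (fun x _ => by simp [min_comm])
  have hR : ∫ t in (0 : ℝ)..1, sliceRevenue f (fun x : ℝ × ℝ => min x.1 x.2 ^ 2) t ≤ 0 := by
    rw [integral_of_le zero_le_one, integral_Ioc_eq_integral_Ioo]
    refine integral_nonpos_of_ae ?_
    filter_upwards [hf.ae_isPositiveProfile, ae_restrict_mem measurableSet_Ioo] with t H ht
    have h1 := H.le_tail_of_le_threshold ht.1 (hcon t ht)
    have h2 : ∫ s in t..1, min t s ^ 2 * phi f (t, s) = t ^ 2 * ∫ s in t..1, phi f (t, s) := by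
      rw [← intervalIntegral.integral_const_mul]
      refine integral_congr fun s hs => ?_
      rw [uIcc_of_le ht.2.le] at hs
      simp only [min_eq_left hs.1]
    simp only [sliceRevenue, Pi.zero_apply]
    rw [h2, min_eq_left ht.2.le, ← mul_sub]
    exact mul_nonpos_of_nonneg_of_nonpos (sq_nonneg t) (by linarith)
  have hne : ∀ᵐ x ∂(volume.restrict square), (x : ℝ × ℝ).1 ≠ x.2 := by
    refine ae_restrict_of_ae ?_
    have := volume_line (a := 1) (b := -1) (by simp) 0
    rw [ae_iff]
    convert this using 3
    ext x
    constructor <;> intro h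
    · simp only [not_not] at *; linarith
    · simp only [not_not] at *; linarith
  have hL : ∫ x in square, (fderiv ℝ (fun x : ℝ × ℝ => min x.1 x.2 ^ 2) x x - min x.1 x.2 ^ 2) * f x
      = ∫ x in square, min x.1 x.2 ^ 2 * f x := by
    refine integral_congr_ae ?_
    filter_upwards [hne] with x hx
    rw [fderiv_min_sq hx]; ring
  have hc : ContinuousOn (fun x : ℝ × ℝ => min x.1 x.2 ^ 2 * f x) square :=
    ContinuousOn.mul (by fun_prop) hf.continuousOn
  have hnn : 0 ≤ᵐ[volume.restrict square] fun x : ℝ × ℝ => min x.1 x.2 ^ 2 * f x :=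
    ae_restrict_square fun x hx => mul_nonneg (sq_nonneg _) (hf.nonneg x (interior_subset hx))
  have hzero : ∫ x in square, min x.1 x.2 ^ 2 * f x = 0 :=
    le_antisymm (by rw [← hL]; linarith [hrev]) (integral_nonneg_of_ae hnn)
  rw [integral_eq_zero_iff_of_nonneg_ae hnn (hc.integrableOn_compact isCompact_square)] at hzero
  have hf0 : f =ᵐ[volume.restrict square] 0 := by
    have hae : ∀ᵐ x ∂(volume.restrict square), x ∈ interior square :=
      ae_restrict_square fun x hx => hx
    filter_upwards [hzero, hae] with x hx hxi
    rw [mem_interior_square] at hxi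
    have : min x.1 x.2 ^ 2 ≠ 0 := by
      have := lt_min hxi.1.1 hxi.2.1
      positivity
    simpa [this] using hx
  have := hf.integral_eq_one
  rw [integral_congr_ae hf0] at this
  simp at this

/-- The secant inequality, cleared of denominators so that degenerate intervals are allowed. -/
lemma _root_.ConvexOn.mul_sub_le {s : Set ℝ} {g : ℝ → ℝ} (hg : ConvexOn ℝ s g) {x y z : ℝ}
    (hx : x ∈ s) (hz : z ∈ s) (hxy : x ≤ y) (hyz : y ≤ z) :
    g y * (z - x) ≤ (z - y) * g x + (y - x) * g z := by
  rcases (hxy.trans hyz).eq_or_lt with rfl | hxz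
  · obtain rfl : y = x := le_antisymm hyz hxy
    simp
  have hD : 0 < z - x := by linarith
  have hconv := hg.2 hx hz (div_nonneg (sub_nonneg.2 hyz) hD.le : 0 ≤ (z - y) / (z - x))
    (div_nonneg (sub_nonneg.2 hxy) hD.le : 0 ≤ (y - x) / (z - x)) (by field_simp; ring)
  simp only [smul_eq_mul] at hconv
  have e : (z - y) / (z - x) * x + (y - x) / (z - x) * z = y := by field_simp; ring
  rwa [e, div_mul_eq_mul_div, div_mul_eq_mul_div, ← add_div, le_div_iff₀ hD] at hconv

lemma _root_.ConcaveOn.le_mul_sub {s : Set ℝ} {g : ℝ → ℝ} (hg : ConcaveOn ℝ s g) {x y z : ℝ}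
    (hx : x ∈ s) (hz : z ∈ s) (hxy : x ≤ y) (hyz : y ≤ z) :
    (z - y) * g x + (y - x) * g z ≤ g y * (z - x) := by
  have := hg.neg.mul_sub_le hx hz hxy hyz
  simp only [Pi.neg_apply] at this
  linarith

/-- `zeta f t` unfolds to the `tailThreshold` of `phi f (t, ·)` and `f (t, 1)`, so the facts about
thresholds apply to it directly. -/
lemma zeta_le_one (f : ℝ × ℝ → ℝ) (t : ℝ) : zeta f t ≤ 1 := tailThreshold_le_one _ _

/-- A convex threshold crosses the diagonal once, from above. -/
lemma IsSRS.exists_crossing {f : ℝ × ℝ → ℝ} (hf : IsSRS f)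
    (hζ : ConvexOn ℝ (Ioo (0 : ℝ) 1) (zeta f)) :
    ∃ τ, 0 ≤ τ ∧ τ < 1 ∧ (∀ t ∈ Ioo τ 1, zeta f t < t) ∧ ∀ t ∈ Ioo 0 τ, t < zeta f t := by
  obtain ⟨t₀, ht₀, hz₀⟩ := hf.exists_zeta_lt
  set A : Set ℝ := {t | t ∈ Ioo (0 : ℝ) 1 ∧ zeta f t < t} with hA
  have hbdd : BddBelow A := ⟨0, fun t ht => ht.1.1.le⟩
  have hne : A.Nonempty := ⟨t₀, ht₀, hz₀⟩
  -- Were the convex `zeta f r - r` negative at `t` and nonnegative at `t' > t`, it would grow at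
  -- least linearly beyond `t'`, against `zeta f r - r ≤ 1 - r` for `r` near `1`.
  have hup : ∀ t ∈ A, ∀ t' ∈ Ioo t 1, zeta f t' < t' := by
    intro t ht t' ht'
    obtain ⟨hti, htz⟩ := ht
    by_contra! hcon
    set ε := t - zeta f t with hε
    have hε0 : 0 < ε := by linarith
    have hd : 0 < t' - t := by linarith [ht'.1]
    have hd1 : 0 < 1 - t' := by linarith [ht'.2]
    obtain ⟨r, hr1, hr2⟩ : ∃ r, t' < r ∧ r < 1 ∧ (1 - r) * (t' - t) < ε * (r - t') := by
      refine ⟨1 - min ((1 - t') / 2) (ε * (1 - t') / 4), ?_, ?_, ?_⟩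
      · linarith [min_le_left ((1 - t') / 2) (ε * (1 - t') / 4)]
      · have : 0 < min ((1 - t') / 2) (ε * (1 - t') / 4) := by positivity
        linarith
      · have h1 := min_le_left ((1 - t') / 2) (ε * (1 - t') / 4)
        have h2 := min_le_right ((1 - t') / 2) (ε * (1 - t') / 4)
        have h0 : 0 < min ((1 - t') / 2) (ε * (1 - t') / 4) := by positivity
        generalize min ((1 - t') / 2) (ε * (1 - t') / 4) = m at *
        have : t' - t < 1 := by linarith [hti.1]
        nlinarith [mul_pos hε0 hd1, mul_nonneg hε0.le (sub_nonneg.2 h1)]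
    have h1 := zeta_le_one f r
    have h2 : t' * (r - t) ≤ (r - t') * zeta f t + (t' - t) * zeta f r :=
      (mul_le_mul_of_nonneg_right hcon (by linarith)).trans
        (hζ.mul_sub_le hti ⟨by linarith [hti.1], hr2.1⟩ ht'.1.le hr1.le)
    have h3 : (t' - t) * zeta f r ≤ (t' - t) * 1 := mul_le_mul_of_nonneg_left h1 hd.le
    have h4 : zeta f t = t - ε := by rw [hε]; ring
    rw [h4] at h2
    nlinarith [hr2.2]
  refine ⟨sInf A, le_csInf hne fun t ht => ht.1.1.le, (csInf_le hbdd ⟨ht₀, hz₀⟩).trans_lt ht₀.2,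
    fun t ht => ?_, fun t ht => ?_⟩
  · obtain ⟨r, hr, hrt⟩ := exists_lt_of_csInf_lt hne ht.1
    exact hup r hr t ⟨hrt, ht.2⟩
  · by_contra! hcon
    -- The infimum gives only the weak inequality. Equality at `t` and strict inequality at `t₀`
    -- would put `zeta f` strictly below the diagonal between them, including at points before `sInf
    -- A`.
    have hlow : ∀ r ∈ Ioo (0 : ℝ) (sInf A), r ≤ zeta f r := by
      intro r hr
      by_contra! h
      have : sInf A ≤ r := csInf_le hbdd
        ⟨⟨hr.1, hr.2.trans_le ((csInf_le hbdd ⟨ht₀, hz₀⟩).trans ht₀.2.le)⟩, h⟩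
      linarith [hr.2]
    have hA0 : sInf A ≤ t₀ := csInf_le hbdd ⟨ht₀, hz₀⟩
    set r := (t + sInf A) / 2 with hr
    have hr1 : t < r := by linarith [ht.2]
    have hr2 : r < t₀ := by linarith [ht.2]
    have hrl := hlow r ⟨by linarith [ht.1], by linarith [ht.2]⟩
    have h2 : r * (t₀ - t) ≤ (t₀ - r) * zeta f t + (r - t) * zeta f t₀ :=
      (mul_le_mul_of_nonneg_right hrl (by linarith)).trans
        (hζ.mul_sub_le ⟨ht.1, by linarith [ht₀.2]⟩ ht₀ hr1.le hr2.le)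
    nlinarith [mul_lt_mul_of_pos_left hz₀ (sub_pos.2 hr1),
      mul_le_mul_of_nonneg_left hcon (sub_nonneg.2 hr2.le)]

end

/-! ### An affine function between a convex and a concave function -/

section

open Filter Topology

/-- A convex function on the line with slopes between `0` and `1` that lies above a concave
function is separated from it by an affine function whose slope lies between `0` and `1`. -/
lemma exists_affine_separating {v g : ℝ → ℝ} {s : Set ℝ} (hv : ConvexOn ℝ univ v)
    (hmono : Monotone v) (hlip : ∀ x y, x ≤ y → v y ≤ v x + (y - x))
    (hg : ConcaveOn ℝ s g) (hs : s.Nonempty) (hle : ∀ t ∈ s, g t ≤ v t) :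
    ∃ α q : ℝ, 0 ≤ q ∧ q ≤ 1 ∧ (∀ t, α + q * t ≤ v t) ∧ ∀ t ∈ s, g t ≤ α + q * t := by
  have hvc : Continuous v := continuousOn_univ.1 (hv.continuousOn isOpen_univ)
  have hconv : Convex ℝ {p : ℝ × ℝ | v p.1 < p.2} := by
    simpa using hv.convex_strict_epigraph
  have hopen : IsOpen {p : ℝ × ℝ | v p.1 < p.2} :=
    isOpen_lt (hvc.comp continuous_fst) continuous_snd
  have hdisj : Disjoint {p : ℝ × ℝ | v p.1 < p.2} {p : ℝ × ℝ | p.1 ∈ s ∧ p.2 ≤ g p.1} := by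
    rw [Set.disjoint_left]
    rintro p (hp : v p.1 < p.2) ⟨hp1, hp2⟩
    linarith [hle _ hp1]
  -- The strict epigraph of `v` is open and convex and misses the hypograph of `g`. A point of `s`
  -- makes the separating line non-vertical (`B < 0`).
  obtain ⟨F, u, h1, h2⟩ := geometric_hahn_banach_open hconv hopen hg.convex_hypograph hdisj
  have hF : ∀ x y : ℝ, F (x, y) = x * F (1, 0) + y * F (0, 1) := fun x y => by
    have : ((x, y) : ℝ × ℝ) = x • (1, 0) + y • (0, 1) := by simp
    rw [this, map_add, map_smul, map_smul, smul_eq_mul, smul_eq_mul]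
  set A := F (1, 0)
  set B := F (0, 1)
  obtain ⟨t₀, ht₀⟩ := hs
  have hB : B < 0 := by
    have a1 := h1 (t₀, v t₀ + 1) (by simp)
    have a2 := h2 (t₀, g t₀) ⟨ht₀, le_rfl⟩
    rw [hF] at a1 a2
    have := hle _ ht₀
    by_contra! hB
    nlinarith
  have hupper : ∀ t, t * A + v t * B ≤ u := by
    intro t
    have hc : Tendsto (fun y : ℝ => t * A + y * B) (𝓝[>] v t) (𝓝 (t * A + v t * B)) :=
      ((by fun_prop : Continuous fun y : ℝ => t * A + y * B).tendsto _).mono_left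
        nhdsWithin_le_nhds
    refine le_of_tendsto hc ?_
    filter_upwards [self_mem_nhdsWithin] with y hy
    have := h1 (t, y) hy
    rw [hF] at this
    exact this.le
  have hL : ∀ t, u / B + (-A / B) * t = (u - t * A) / B := fun t => by ring
  have hLv : ∀ t, u / B + (-A / B) * t ≤ v t := fun t => by
    rw [hL, div_le_iff_of_neg hB]
    linarith [hupper t]
  refine ⟨u / B, -A / B, ?_, ?_, hLv, fun t ht => ?_⟩
  -- The line stays below `v` on all of `ℝ`. A negative slope would overtake the monotone `v` far to
  -- the left, a slope above one the 1-Lipschitz `v` far to the right.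
  · by_contra! hq
    have h0 := hLv 0
    have hT : (v 0 - u / B + 1) / (-A / B) ≤ 0 :=
      div_nonpos_of_nonneg_of_nonpos (by linarith) hq.le
    have h3 := hLv ((v 0 - u / B + 1) / (-A / B))
    have h4 := hmono hT
    rw [mul_div_cancel₀ _ hq.ne] at h3
    linarith
  · by_contra! hq
    have h0 := hLv 0
    have hq' : 0 < -A / B - 1 := by linarith
    set T := (v 0 - u / B + 1) / (-A / B - 1) with hTdef
    have hT : 0 ≤ T := div_nonneg (by linarith) hq'.le
    have h3 := hLv T
    have h4 := hlip 0 T hT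
    have h5 : T * (-A / B - 1) = v 0 - u / B + 1 := by
      rw [hTdef, div_mul_cancel₀ _ hq'.ne']
    linarith
  · rw [hL, le_div_iff_of_neg hB]
    have := h2 (t, g t) ⟨ht, le_rfl⟩
    rw [hF] at this
    linarith

/-- The chord of a convex function over the interval on which it lies below a concave function
lies between the two functions. -/
lemma exists_chord_between {v g : ℝ → ℝ} {τ : ℝ} (hv : ConvexOn ℝ univ v)
    (hg : ConcaveOn ℝ (Ioo 0 τ) g) {t₀ : ℝ} (ht₀ : t₀ ∈ Ioo 0 τ) (hlt : v t₀ < g t₀) :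
    ∃ c d : ℝ, c < d ∧ d ≤ τ ∧ ∀ t ∈ Ioo 0 τ,
      (min (v t) (g t)) * (d - c) ≤ (d - t) * v c + (t - c) * v d ∧
      (d - t) * v c + (t - c) * v d ≤ (max (v t) (g t)) * (d - c) := by
  have hvc : Continuous v := continuousOn_univ.1 (hv.continuousOn isOpen_univ)
  have hgc : ContinuousOn g (Ioo 0 τ) := hg.continuousOn isOpen_Ioo
  -- `D` turns out to be the interval `(c, d)`. Its ends may be `0` and `τ`, where nothing is known
  -- about `g`, so concavity is used at points inside and passed to the limit.
  set D : Set ℝ := Ioo 0 τ ∩ (fun t => g t - v t) ⁻¹' Ioi 0 with hD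
  have hDo : IsOpen D :=
    (hgc.sub hvc.continuousOn).isOpen_inter_preimage isOpen_Ioo isOpen_Ioi
  have hDlt : ∀ t ∈ D, v t < g t := fun t ht => by
    have : 0 < g t - v t := ht.2
    linarith
  have hmemD : ∀ t ∈ Ioo 0 τ, t ∉ D → g t ≤ v t := fun t ht htD => by
    by_contra! h
    exact htD ⟨ht, show 0 < g t - v t by linarith⟩
  have ht₀D : t₀ ∈ D := ⟨ht₀, show 0 < g t₀ - v t₀ by linarith⟩
  have hbb : BddBelow D := ⟨0, fun t ht => ht.1.1.le⟩
  have hba : BddAbove D := ⟨τ, fun t ht => ht.1.2.le⟩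
  set c := sInf D with hc
  set d := sSup D with hd
  have hcD : c ∉ D := fun h => by
    obtain ⟨ε, hε, hb⟩ := Metric.isOpen_iff.1 hDo c h
    have : c - ε / 2 ∈ D := hb (by rw [Metric.mem_ball, Real.dist_eq, abs_lt]; constructor <;> linarith)
    linarith [csInf_le hbb this]
  have hdD : d ∉ D := fun h => by
    obtain ⟨ε, hε, hb⟩ := Metric.isOpen_iff.1 hDo d h
    have : d + ε / 2 ∈ D := hb (by rw [Metric.mem_ball, Real.dist_eq, abs_lt]; constructor <;> linarith)
    linarith [le_csSup hba this]
  have hct : c < t₀ := lt_of_le_of_ne (csInf_le hbb ht₀D) fun h => hcD (h ▸ ht₀D)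
  have htd : t₀ < d := lt_of_le_of_ne (le_csSup hba ht₀D) fun h => hdD (h ▸ ht₀D)
  have hcd : c < d := hct.trans htd
  have hc0 : 0 ≤ c := le_csInf ⟨t₀, ht₀D⟩ fun t ht => ht.1.1.le
  have hdτ : d ≤ τ := csSup_le ⟨t₀, ht₀D⟩ fun t ht => ht.1.2.le
  have hsub : ∀ t ∈ Ioo c d, v t < g t := by
    intro t ht
    obtain ⟨x, hx, hxt⟩ := exists_lt_of_csInf_lt ⟨t₀, ht₀D⟩ ht.1
    obtain ⟨z, hz, htz⟩ := exists_lt_of_lt_csSup ⟨t₀, ht₀D⟩ ht.2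
    have h1 := hv.mul_sub_le (mem_univ x) (mem_univ z) hxt.le htz.le
    have h2 := hg.le_mul_sub hx.1 hz.1 hxt.le htz.le
    have h3 := mul_lt_mul_of_pos_left (hDlt x hx) (sub_pos.2 htz)
    have h4 := mul_lt_mul_of_pos_left (hDlt z hz) (sub_pos.2 hxt)
    exact lt_of_mul_lt_mul_right (a := z - x) (by linarith) (by linarith)
  refine ⟨c, d, hcd, hdτ, fun t ht => ?_⟩
  rcases le_or_gt t c with htc | htc
  · have hc' : c ∈ Ioo 0 τ := ⟨ht.1.trans_le htc, hcd.trans_le hdτ⟩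
    have hgv : g t ≤ v t := hmemD t ht fun h =>
      hcD ((le_antisymm htc (csInf_le hbb h) : t = c) ▸ h)
    rw [min_eq_right hgv, max_eq_left hgv]
    have h1 := hv.mul_sub_le (mem_univ t) (mem_univ d) htc hcd.le
    refine ⟨?_, by linarith⟩
    have hlim : Tendsto (fun y => (y - c) * g t + (c - t) * v y - v c * (y - t)) (𝓝[<] d)
        (𝓝 ((d - c) * g t + (c - t) * v d - v c * (d - t))) :=
      ((by fun_prop : Continuous fun y => (y - c) * g t + (c - t) * v y - v c * (y - t)).tendsto
        _).mono_left nhdsWithin_le_nhds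
    have := le_of_tendsto (b := 0) hlim (by
      filter_upwards [Ioo_mem_nhdsLT hcd] with y hy
      have a1 := hg.le_mul_sub ht ⟨hc'.1.trans hy.1, hy.2.trans_le hdτ⟩ htc hy.1.le
      have a2 := mul_le_mul_of_nonneg_left (hsub y hy).le (sub_nonneg.2 htc)
      have a3 := mul_le_mul_of_nonneg_right (hmemD c hc' hcD)
        (by linarith [hy.1] : 0 ≤ y - t)
      linarith)
    linarith
  rcases le_or_gt d t with hdt | hdt
  · have hd' : d ∈ Ioo 0 τ := ⟨hc0.trans_lt hcd, hdt.trans_lt ht.2⟩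
    have hgv : g t ≤ v t := hmemD t ht fun h =>
      hdD ((le_antisymm (le_csSup hba h) hdt : t = d) ▸ h)
    rw [min_eq_right hgv, max_eq_left hgv]
    have h1 := hv.mul_sub_le (mem_univ c) (mem_univ t) hcd.le hdt
    refine ⟨?_, by linarith⟩
    have hlim : Tendsto (fun y => (t - d) * v y + (d - y) * g t - v d * (t - y)) (𝓝[>] c)
        (𝓝 ((t - d) * v c + (d - c) * g t - v d * (t - c))) :=
      ((by fun_prop : Continuous fun y => (t - d) * v y + (d - y) * g t - v d * (t - y)).tendsto
        _).mono_left nhdsWithin_le_nhds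
    have := le_of_tendsto (b := 0) hlim (by
      filter_upwards [Ioo_mem_nhdsGT hcd] with y hy
      have a1 := hg.le_mul_sub ⟨hc0.trans_lt hy.1, hy.2.trans hd'.2⟩ ht hy.2.le hdt
      have a2 := mul_le_mul_of_nonneg_left (hsub y hy).le (sub_nonneg.2 hdt)
      have a3 := mul_le_mul_of_nonneg_right (hmemD d hd' hdD)
        (by linarith [hy.2] : 0 ≤ t - y)
      linarith)
    linarith
  · have hvg := (hsub t ⟨htc, hdt⟩).le
    rw [min_eq_left hvg, max_eq_right hvg]
    have h1 := hv.mul_sub_le (mem_univ c) (mem_univ d) htc.le hdt.le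
    refine ⟨by linarith, ?_⟩
    have hlim : Tendsto (fun e : ℝ => (d - e * (d - t) - t) * v (c + e * (t - c))
        + (t - (c + e * (t - c))) * v (d - e * (d - t))
        - g t * (d - e * (d - t) - (c + e * (t - c)))) (𝓝[>] 0)
        (𝓝 ((d - 0 * (d - t) - t) * v (c + 0 * (t - c))
        + (t - (c + 0 * (t - c))) * v (d - 0 * (d - t))
        - g t * (d - 0 * (d - t) - (c + 0 * (t - c))))) :=
      ((by fun_prop : Continuous fun e : ℝ => (d - e * (d - t) - t) * v (c + e * (t - c))
        + (t - (c + e * (t - c))) * v (d - e * (d - t))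
        - g t * (d - e * (d - t) - (c + e * (t - c)))).tendsto _).mono_left nhdsWithin_le_nhds
    have := le_of_tendsto (b := 0) hlim (by
      filter_upwards [Ioo_mem_nhdsGT (show (0 : ℝ) < 1 by norm_num)] with e he
      have p1 : 0 < e * (t - c) := mul_pos he.1 (sub_pos.2 htc)
      have p2 : 0 < e * (d - t) := mul_pos he.1 (sub_pos.2 hdt)
      have p3 : 0 < (1 - e) * (t - c) := mul_pos (sub_pos.2 he.2) (sub_pos.2 htc)
      have p4 : 0 < (1 - e) * (d - t) := mul_pos (sub_pos.2 he.2) (sub_pos.2 hdt)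
      set x := c + e * (t - c)
      set z := d - e * (d - t)
      have hx : x ∈ Ioo c d := ⟨by linarith, by linarith⟩
      have hz : z ∈ Ioo c d := ⟨by linarith, by linarith⟩
      have hxt : x ≤ t := by linarith
      have htz : t ≤ z := by linarith
      have a1 := hg.le_mul_sub ⟨hc0.trans_lt hx.1, hx.2.trans_le hdτ⟩
        ⟨hc0.trans_lt hz.1, hz.2.trans_le hdτ⟩ hxt htz
      have a2 := mul_le_mul_of_nonneg_left (hsub x hx).le (sub_nonneg.2 htz)
      have a3 := mul_le_mul_of_nonneg_left (hsub z hz).le (sub_nonneg.2 hxt)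
      linarith)
    simp only [zero_mul, add_zero, sub_zero] at this
    linarith

/-- If `g ≤ v` throughout, a separating line serves; otherwise the chord of `v` over the interval
where `v < g`. At `τ` the chord's line is below `v` since `τ` lies beyond the chord. -/
theorem exists_affine_between {v g : ℝ → ℝ} {τ : ℝ} (hv : ConvexOn ℝ univ v)
    (hmono : Monotone v) (hlip : ∀ x y, x ≤ y → v y ≤ v x + (y - x))
    (hg : ConcaveOn ℝ (Ioo 0 τ) g) :
    ∃ α q : ℝ, 0 ≤ q ∧ q ≤ 1 ∧ α + q * τ ≤ v τ ∧ ∀ t ∈ Ioo 0 τ,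
      min (v t) (g t) ≤ α + q * t ∧ α + q * t ≤ max (v t) (g t) := by
  rcases (Ioo 0 τ).eq_empty_or_nonempty with he | hne
  · refine ⟨v τ, 0, le_rfl, zero_le_one, by simp, fun t ht => ?_⟩
    rw [he] at ht
    exact ht.elim
  by_cases hle : ∀ t ∈ Ioo 0 τ, g t ≤ v t
  · obtain ⟨α, q, hq0, hq1, h1, h2⟩ := exists_affine_separating hv hmono hlip hg hne hle
    refine ⟨α, q, hq0, hq1, h1 τ, fun t ht => ?_⟩
    rw [min_eq_right (hle t ht), max_eq_left (hle t ht)]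
    exact ⟨h2 t ht, h1 t⟩
  push Not at hle
  obtain ⟨t₀, ht₀, hlt⟩ := hle
  obtain ⟨c, d, hcd, hdτ, hb⟩ := exists_chord_between hv hg ht₀ hlt
  have hD : 0 < d - c := sub_pos.2 hcd
  have hL : ∀ t, v c - (v d - v c) / (d - c) * c + (v d - v c) / (d - c) * t
      = ((d - t) * v c + (t - c) * v d) / (d - c) := fun t => by field_simp; ring
  refine ⟨v c - (v d - v c) / (d - c) * c, (v d - v c) / (d - c),
    div_nonneg (sub_nonneg.2 (hmono hcd.le)) hD.le, ?_, ?_, fun t ht => ?_⟩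
  · rw [div_le_one hD]
    linarith [hlip c d hcd.le]
  · rw [hL, div_le_iff₀ hD]
    linarith [hv.mul_sub_le (mem_univ c) (mem_univ τ) hcd.le hdτ]
  · rw [hL, le_div_iff₀ hD, div_le_iff₀ hD]
    exact hb t ht

end

/-! ### Three-bundle menus and the revenue comparison -/

section

open Filter Topology intervalIntegral

/-- The indirect utility of the menu offering `(q, 1)` and `(1, q)` at price `1 - α` and `(1, 1)`
at price `1 - β`. -/
def menuUtility (α β q : ℝ) (x : ℝ × ℝ) : ℝ :=
  max (max 0 (β + x.1 + x.2 - 1)) (max (α + q * x.1 + x.2 - 1) (α + q * x.2 + x.1 - 1))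

open Classical in
/-- A price schedule implementing `menuUtility`; all bundles off the menu are prohibitively
expensive. -/
def menuPrice (α β q : ℝ) (r : ℝ × ℝ) : ℝ :=
  if r = (0, 0) then 0 else if r = (1, 1) then 1 - β
    else if r = (q, 1) ∨ r = (1, q) then 1 - α else 2

lemma isPriceSchedule_menuPrice (α β q : ℝ) : IsPriceSchedule (menuPrice α β q) where
  zero := by simp [menuPrice]
  bddBelow := by
    refine ⟨min 0 (min (1 - β) (1 - α)), ?_⟩
    rintro _ ⟨r, -, rfl⟩
    unfold menuPrice
    split_ifs
    · exact min_le_left _ _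
    · exact (min_le_right _ _).trans (min_le_left _ _)
    · exact (min_le_right _ _).trans (min_le_right _ _)
    · exact (min_le_left _ _).trans zero_le_two

lemma utility_menuPrice {α β q : ℝ} (hq0 : 0 ≤ q) (hq1 : q < 1) {x : ℝ × ℝ} (hx : x ∈ square) :
    utility (menuPrice α β q) x = menuUtility α β q x := by
  have hp := isPriceSchedule_menuPrice α β q
  refine le_antisymm (utility_le fun r hr => ?_) ?_
  · unfold menuPrice
    split_ifs with h1 h2 h3
    · subst h1
      simp [menuUtility]
    · subst h2
      refine le_trans (le_of_eq ?_) ((le_max_right _ _).trans (le_max_left _ _))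
      ring
    · rcases h3 with rfl | rfl
      · refine le_trans (le_of_eq ?_) ((le_max_left _ _).trans (le_max_right _ _))
        ring
      · refine le_trans (le_of_eq ?_) ((le_max_right _ _).trans (le_max_right _ _))
        ring
    -- No bundle is worth more than `2` to a type in the square, so this price never beats the
    -- outside option.
    · refine le_trans ?_ ((le_max_left _ _).trans (le_max_left _ _))
      rw [mem_square] at hx hr
      nlinarith [mul_le_mul hx.1.2 hr.1.2 hr.1.1 zero_le_one,
        mul_le_mul hx.2.2 hr.2.2 hr.2.1 zero_le_one]
  · have hne : ((1 : ℝ), q) ≠ (1, 1) := fun h => hq1.ne (Prod.ext_iff.1 h).2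
    have hne' : (q, (1 : ℝ)) ≠ (1, 1) := fun h => hq1.ne (Prod.ext_iff.1 h).1
    have e1 := hp.le_utility x (q := (1, 1)) (by simp [mem_square])
    have e2 := hp.le_utility x (q := (q, 1)) (by simp [mem_square, hq0, hq1.le])
    have e3 := hp.le_utility x (q := (1, q)) (by simp [mem_square, hq0, hq1.le])
    simp only [menuPrice, hne, hne', Prod.mk.injEq, one_ne_zero, and_false, false_and, if_false,
      if_true, true_or, or_true, and_self] at e1 e2 e3
    refine max_le (max_le (hp.utility_nonneg x) ?_) (max_le ?_ ?_) <;> linarith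

/-- Above the diagonal `(1, q)` is no better than `(q, 1)`. The resulting form is exactly the lower
bound of `ubar_sub_le_utility`, so the menu attains the slice bound wherever its top-edge value is
nonnegative. -/
lemma menuUtility_of_le {α β q : ℝ} (hq1 : q ≤ 1) {t s : ℝ} (hts : t ≤ s) :
    menuUtility α β q (t, s) = max 0 (max (α + q * t) (β + t) + s - 1) := by
  have h1 : α + q * s + t - 1 ≤ α + q * t + s - 1 := by nlinarith
  simp only [menuUtility]
  rw [max_eq_left h1, max_assoc]
  congr 1
  rcases le_total (α + q * t) (β + t) with h | h
  · rw [max_eq_right h, max_eq_left (by linarith)]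
  · rw [max_eq_left h, max_eq_right (by linarith)]

lemma menuUtility_swap (α β q : ℝ) (x : ℝ × ℝ) :
    menuUtility α β q x.swap = menuUtility α β q x := by
  simp only [menuUtility, Prod.fst_swap, Prod.snd_swap]
  rw [max_comm (α + q * x.2 + x.1 - 1), add_right_comm]

/-- For every mechanism there is a two-piece function which, along the top edge, is at least as
close to the pointwise revenue maximizer as the mechanism's indirect utility. -/
lemma IsSRS.exists_improving_menu {f : ℝ × ℝ → ℝ} (hf : IsSRS f)
    (hζ : ConvexOn ℝ (Ioo (0 : ℝ) 1) (zeta f)) {p : ℝ × ℝ → ℝ} (hp : IsPriceSchedule p) :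
    ∃ α β q τ : ℝ, 0 ≤ q ∧ q < 1 ∧ 0 ≤ τ ∧ τ < 1 ∧ α + q * τ ≤ β + τ ∧
      (∀ t ∈ Ioo τ 1, zeta f t < t ∧ ubar p t ≤ max (α + q * t) (β + t)) ∧
      ∀ t ∈ Ioo 0 τ, t < zeta f t ∧
        min (ubar p t) (1 - zeta f t) ≤ max (α + q * t) (β + t) ∧
        max (α + q * t) (β + t) ≤ max (ubar p t) (1 - zeta f t) := by
  obtain ⟨τ, hτ0, hτ1, hup, hlow⟩ := hf.exists_crossing hζ
  have hg : ConcaveOn ℝ (Ioo 0 τ) fun t => 1 - zeta f t :=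
    (concaveOn_const 1 (convex_Ioo 0 τ)).sub
      (hζ.subset (Ioo_subset_Ioo_right hτ1.le) (convex_Ioo 0 τ))
  obtain ⟨α, q, hq0, hq1, hατ, hb⟩ := exists_affine_between hp.convexOn_ubar hp.monotone_ubar
    (fun x y h => hp.ubar_le_add h) hg
  set v := ubar p with hv
  -- The slope-one line through `(τ, v τ)` lies above `v` to the right of `τ` and below it to the
  -- left.
  have key1 : ∀ t ∈ Ioo τ 1, v t ≤ v τ - τ + t := fun t ht => by
    have : v t ≤ v τ + (t - τ) := hp.ubar_le_add ht.1.le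
    linarith
  have key2 : ∀ t ∈ Ioo 0 τ, v τ - τ + t ≤ v t := fun t ht => by
    have : v τ ≤ v t + (τ - t) := hp.ubar_le_add ht.2.le
    linarith
  have hbw : ∀ t ∈ Ioo 0 τ, min (v t) (1 - zeta f t) ≤ max (α + q * t) (v τ - τ + t) ∧
        max (α + q * t) (v τ - τ + t) ≤ max (v t) (1 - zeta f t) := fun t ht =>
    ⟨(hb t ht).1.trans (le_max_left _ _),
      max_le (hb t ht).2 ((key2 t ht).trans (le_max_left _ _))⟩
  rcases hq1.lt_or_eq with hq1 | rfl
  · exact ⟨α, v τ - τ, q, τ, hq0, hq1, hτ0, hτ1, by linarith,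
      fun t ht => ⟨hup t ht, (key1 t ht).trans (le_max_right _ _)⟩,
      fun t ht => ⟨hlow t ht, hbw t ht⟩⟩
  -- For slope one the two pieces merge into a single slope-one line, rewritten with `q = 0` and `α
  -- = β` to keep `q < 1`.
  · have e : ∀ t, 0 < t → max (v τ - τ + 0 * t) (v τ - τ + t) = v τ - τ + t := fun t ht =>
      max_eq_right (by linarith)
    have e' : ∀ t, max (α + 1 * t) (v τ - τ + t) = v τ - τ + t := fun t =>
      max_eq_right (by linarith)
    refine ⟨v τ - τ, v τ - τ, 0, τ, le_rfl, one_pos, hτ0, hτ1, by linarith,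
      fun t ht => ⟨hup t ht, (key1 t ht).trans (le_max_right _ _)⟩,
      fun t ht => ⟨hlow t ht, ?_⟩⟩
    rw [e t ht.1, ← e' t]
    exact hbw t ht

lemma ubar_sub_le_utility {p : ℝ × ℝ → ℝ} (hp : IsPriceSchedule p) {t s : ℝ} (hs : s ≤ 1) :
    max 0 (ubar p t + s - 1) ≤ utility p (t, s) := by
  have := hp.utility_le_add (x := (t, s)) (y := (t, 1)) le_rfl hs
  refine max_le (hp.utility_nonneg _) ?_
  simp only [ubar]
  linarith

/-- With a positive weight `phi f`, the pointwise least utility below the given top value is best;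
equality of the integrals gives equality almost everywhere, then everywhere by continuity. -/
lemma IsPositiveProfile.sliceRevenue_le {f p : ℝ × ℝ → ℝ} (hp : IsPriceSchedule p) {t : ℝ}
    (ht : t ∈ Ioo (0 : ℝ) 1) (H : IsPositiveProfile (fun s => phi f (t, s)) (f (t, 1))) :
    sliceRevenue f (utility p) t
        ≤ segmentRevenue (fun s => phi f (t, s)) (f (t, 1)) t (ubar p t) ∧
      (sliceRevenue f (utility p) t
        = segmentRevenue (fun s => phi f (t, s)) (f (t, 1)) t (ubar p t) →
        ∀ s ∈ Icc t 1, utility p (t, s) = max 0 (ubar p t + s - 1)) := by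
  have hu : Continuous fun s => utility p (t, s) :=
    hp.lipschitzWith_utility.continuous.comp (by fun_prop)
  have ht' : t ∈ Icc (0 : ℝ) 1 := ⟨ht.1.le, ht.2.le⟩
  have h1 : (1 : ℝ) ∈ Icc (0 : ℝ) 1 := ⟨zero_le_one, le_rfl⟩
  have hi1 := H.integrable_mul (k := fun s => max 0 (ubar p t + s - 1)) (by fun_prop) ht' h1
  have hi2 := H.integrable_mul hu ht' h1
  rw [intervalIntegrable_iff_integrableOn_Ioc_of_le ht.2.le] at hi1 hi2
  have hle : (fun s => max 0 (ubar p t + s - 1) * phi f (t, s)) ≤ᵐ[volume.restrict (Ioc t 1)]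
      fun s => utility p (t, s) * phi f (t, s) := by
    filter_upwards [H.ae_pos ht.1.le le_rfl, ae_restrict_mem measurableSet_Ioc] with s hs hsm
    exact mul_le_mul_of_nonneg_right (ubar_sub_le_utility hp hsm.2) hs.le
  have hmono := integral_mono_ae hi1 hi2 hle
  have e : sliceRevenue f (utility p) t
      = ubar p t * f (t, 1) - ∫ s in Ioc t 1, utility p (t, s) * phi f (t, s) := by
    rw [sliceRevenue, integral_of_le ht.2.le, ubar]
  rw [e, segmentRevenue, integral_of_le ht.2.le]
  refine ⟨by linarith, fun heq => ?_⟩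
  have heq' := (integral_eq_iff_of_ae_le hi1 hi2 hle).1 (by linarith)
  have hae : (fun s => utility p (t, s)) =ᵐ[volume.restrict (Icc t 1)]
      fun s => max 0 (ubar p t + s - 1) := by
    rw [Measure.restrict_congr_set Ioc_ae_eq_Icc.symm]
    filter_upwards [heq', H.ae_pos ht.1.le le_rfl] with s hs hpos
    exact (mul_right_cancel₀ hpos.ne' hs).symm
  exact Measure.eqOn_Icc_of_ae_eq volume ht.2.ne hae hu.continuousOn (by fun_prop)

/-- A symmetric optimal mechanism is a menu with at most three nonzero bundles. -/
theorem IsSRS.exists_menu_eq {f : ℝ × ℝ → ℝ} (hf : IsSRS f)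
    (hζ : ConvexOn ℝ (Ioo (0 : ℝ) 1) (zeta f)) {p : ℝ × ℝ → ℝ} (hp : IsOptimal f p)
    (hsymm : IsSymmetricMechanism p) :
    ∃ α β q τ : ℝ, 0 ≤ q ∧ q < 1 ∧ τ < 1 ∧ 0 ≤ τ ∧ α + q * τ ≤ β + τ ∧
      (∀ t ∈ Icc (0 : ℝ) 1, ubar p t = max (α + q * t) (β + t)) ∧
      ∀ x ∈ interior square, utility p x = menuUtility α β q x := by
  have hps := hp.isPriceSchedule
  obtain ⟨α, β, q, τ, hq0, hq1, hτ0, hτ1, hατ, hup, hlow⟩ := hf.exists_improving_menu hζ hps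
  refine ⟨α, β, q, τ, hq0, hq1, hτ1, hτ0, hατ, ?_⟩
  set w : ℝ → ℝ := fun t => max (α + q * t) (β + t) with hw
  have hwc : Continuous w := by fun_prop
  set p' := menuPrice α β q
  have hps' : IsPriceSchedule p' := isPriceSchedule_menuPrice α β q
  have hsym : ∀ x ∈ square, utility p x.swap = utility p x := fun x hx =>
    (hsymm x.1 hx.1 x.2 hx.2).symm
  have hsym' : ∀ x ∈ square, utility p' x.swap = utility p' x := fun x hx => by
    rw [utility_menuPrice hq0 hq1 hx, utility_menuPrice hq0 hq1 (x := x.swap) ⟨hx.2, hx.1⟩,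
      menuUtility_swap]
  have hR := hp.revenue_le p' hps'
  rw [revenue, revenue, hf.integral_radial_of_symm hps.lipschitzWith_utility.lipschitzOnWith hsym,
    hf.integral_radial_of_symm hps'.lipschitzWith_utility.lipschitzOnWith hsym'] at hR
  have hi := hf.intervalIntegrable_sliceRevenue
    (hps.lipschitzWith_utility.continuous.continuousOn (s := square))
  have hi' := hf.intervalIntegrable_sliceRevenue
    (hps'.lipschitzWith_utility.continuous.continuousOn (s := square))
  rw [intervalIntegrable_iff_integrableOn_Ioo_of_le zero_le_one] at hi hi'
  rw [integral_of_le zero_le_one, integral_of_le zero_le_one, integral_Ioc_eq_integral_Ioo,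
    integral_Ioc_eq_integral_Ioo] at hR
  have hτne : ∀ᵐ t ∂(volume.restrict (Ioo (0 : ℝ) 1)), t ≠ τ :=
    ae_restrict_of_ae (by simp [ae_iff])
  have hslice : ∀ᵐ t ∂(volume.restrict (Ioo (0 : ℝ) 1)), sliceRevenue f (utility p') t
      = segmentRevenue (fun s => phi f (t, s)) (f (t, 1)) t (w t) := by
    filter_upwards [hτne, ae_restrict_mem measurableSet_Ioo] with t htτ ht
    have hv0 : 0 ≤ ubar p t := hps.utility_nonneg _
    -- Needed because the menu's utility at the top is `max 0 (w t)`.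
    have hw0 : 0 ≤ w t := by
      rcases lt_or_gt_of_ne htτ with h | h
      · exact (le_min hv0 (sub_nonneg.2 (zeta_le_one f t))).trans (hlow t ⟨ht.1, h⟩).2.1
      · exact hv0.trans (hup t ⟨h, ht.2⟩).2
    have hval : ∀ s ∈ Icc t 1, utility p' (t, s) = max 0 (w t + s - 1) := fun s hs => by
      rw [utility_menuPrice hq0 hq1 (mem_square.2 ⟨⟨ht.1.le, ht.2.le⟩, ht.1.le.trans hs.1, hs.2⟩),
        menuUtility_of_le hq1.le hs.1]
    rw [sliceRevenue, segmentRevenue, hval 1 ⟨ht.2.le, le_rfl⟩, add_sub_cancel_right,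
      max_eq_right hw0]
    congr 1
    refine integral_congr fun s hs => ?_
    rw [uIcc_of_le ht.2.le] at hs
    simp only [hval s hs]
  have hcmp : ∀ᵐ t ∂(volume.restrict (Ioo (0 : ℝ) 1)),
      sliceRevenue f (utility p) t ≤ sliceRevenue f (utility p') t ∧
      (sliceRevenue f (utility p) t = sliceRevenue f (utility p') t →
        ubar p t = w t ∧ ∀ s ∈ Icc t 1, utility p (t, s) = max 0 (w t + s - 1)) := by
    filter_upwards [hτne, ae_restrict_mem measurableSet_Ioo, hslice, hf.ae_isPositiveProfile]
      with t htτ ht hs H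
    have hv0 : 0 ≤ ubar p t := hps.utility_nonneg _
    obtain ⟨h1, h2⟩ := H.sliceRevenue_le hps ht
    rw [hs]
    by_cases hvw : ubar p t = w t
    · rw [← hvw]
      exact ⟨h1, fun h => ⟨rfl, h2 h⟩⟩
    · have hlt : segmentRevenue (fun s => phi f (t, s)) (f (t, 1)) t (ubar p t)
          < segmentRevenue (fun s => phi f (t, s)) (f (t, 1)) t (w t) := by
        rcases lt_or_gt_of_ne htτ with h | h
        · obtain ⟨c1, c2, c3⟩ := hlow t ⟨ht.1, h⟩
          exact H.segmentRevenue_lt_of_between ht.1 c1 hv0 hvw c2 c3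
        · obtain ⟨c1, c2⟩ := hup t ⟨h, ht.2⟩
          exact H.segmentRevenue_lt_of_threshold_lt ht.2.le c1 hv0 (lt_of_le_of_ne c2 hvw)
      exact ⟨by linarith, fun h => by linarith⟩
  have hle : sliceRevenue f (utility p) ≤ᵐ[volume.restrict (Ioo (0 : ℝ) 1)]
      sliceRevenue f (utility p') := hcmp.mono fun t ht => ht.1
  -- Optimality of `p` reverses the integrated slice inequality, so the slices agree almost
  -- everywhere.
  have heq := (integral_eq_iff_of_ae_le hi hi' hle).1
    (le_antisymm (integral_mono_ae hi hi' hle) (by linarith))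
  have hall : ∀ᵐ t ∂(volume.restrict (Ioo (0 : ℝ) 1)), ubar p t = w t ∧
      ∀ s ∈ Icc t 1, utility p (t, s) = max 0 (w t + s - 1) := by
    filter_upwards [hcmp, heq] with t h1 h2 using h1.2 h2
  have hubar : EqOn (ubar p) w (Icc 0 1) := by
    refine Measure.eqOn_Icc_of_ae_eq volume zero_ne_one ?_ hps.continuous_ubar.continuousOn
      hwc.continuousOn
    rw [Measure.restrict_congr_set Ioo_ae_eq_Icc.symm]
    exact hall.mono fun t ht => ht.1
  -- Equality is known for almost every `t` and all `s ≥ t`; at fixed `s`, continuity in `t` removes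
  -- the exceptional set.
  have hupper : ∀ s ∈ Ioo (0 : ℝ) 1, ∀ t ∈ Icc 0 s, utility p (t, s) = max 0 (w t + s - 1) := by
    intro s hs
    refine Measure.eqOn_Icc_of_ae_eq (f := fun t => utility p (t, s))
      (g := fun t => max 0 (w t + s - 1)) volume hs.1.ne ?_
      (hps.lipschitzWith_utility.continuous.comp (by fun_prop)).continuousOn
      (by fun_prop)
    rw [Measure.restrict_congr_set Ioo_ae_eq_Icc.symm]
    have := ae_mono (Measure.restrict_mono (Ioo_subset_Ioo_right hs.2.le) le_rfl) hall
    filter_upwards [this, ae_restrict_mem measurableSet_Ioo] with t ht htm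
    exact ht.2 s ⟨htm.2.le, hs.2.le⟩
  refine ⟨hubar, fun x hx => ?_⟩
  have hxm := mem_interior_square.1 hx
  rcases le_total x.1 x.2 with h | h
  · rw [show x = (x.1, x.2) from rfl, menuUtility_of_le hq1.le h]
    exact hupper x.2 hxm.2 x.1 ⟨hxm.1.1.le, h⟩
  · rw [← hsym x (interior_subset hx), ← menuUtility_swap, show x.swap = (x.2, x.1) from rfl,
      menuUtility_of_le hq1.le h]
    exact hupper x.1 hxm.1 x.2 ⟨hxm.2.1.le, h⟩

end

/-! ### Demand sets and active bundles -/

section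

open Filter Topology

/-- Where the indirect utility is locally affine, the demanded bundle is its slope. -/
lemma eq_of_mem_demandSet {p : ℝ × ℝ → ℝ} {x r g : ℝ × ℝ} {k : ℝ} (hx : x ∈ interior square)
    (hu : ∀ᶠ y in 𝓝 x, utility p y = y.1 * g.1 + y.2 * g.2 + k) (hr : x ∈ demandSet p r) :
    r = g := by
  -- Testing the demand inequality at a type shifted slightly towards `r - g` bounds the squared
  -- distance from `r` to `g` by zero.
  have hlim : Tendsto (fun δ : ℝ => (x.1 + δ * (r.1 - g.1), x.2 + δ * (r.2 - g.2)))
      (𝓝[>] 0) (𝓝 x) := by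
    have : Continuous fun δ : ℝ => (x.1 + δ * (r.1 - g.1), x.2 + δ * (r.2 - g.2)) := by fun_prop
    have h := this.tendsto 0
    simp only [zero_mul, add_zero] at h
    exact h.mono_left nhdsWithin_le_nhds
  have hev := hlim.eventually (hu.and (mem_interior_iff_mem_nhds.1 hx))
  obtain ⟨δ, ⟨h1, h2⟩, hδ⟩ := (hev.and self_mem_nhdsWithin).exists
  have hδ : 0 < δ := hδ
  have h3 := hr.2 _ h2
  rw [h1, hu.self_of_nhds] at h3
  simp only at h3
  have h4 : δ * ((r.1 - g.1) ^ 2 + (r.2 - g.2) ^ 2) ≤ 0 := by nlinarith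
  have h5 : (r.1 - g.1) ^ 2 + (r.2 - g.2) ^ 2 ≤ 0 := nonpos_of_mul_nonpos_right h4 hδ
  have e1 : (r.1 - g.1) ^ 2 = 0 := by nlinarith [sq_nonneg (r.1 - g.1), sq_nonneg (r.2 - g.2)]
  have e2 : (r.2 - g.2) ^ 2 = 0 := by nlinarith [sq_nonneg (r.1 - g.1), sq_nonneg (r.2 - g.2)]
  ext
  · exact sub_eq_zero.1 (pow_eq_zero_iff two_ne_zero |>.1 e1)
  · exact sub_eq_zero.1 (pow_eq_zero_iff two_ne_zero |>.1 e2)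

lemma eventually_max_eq {X : Type*} [TopologicalSpace X] {F G : X → ℝ} (hF : Continuous F)
    (hG : Continuous G) {x : X} (hne : F x ≠ G x) :
    (∀ᶠ y in 𝓝 x, max (F y) (G y) = F y) ∨ ∀ᶠ y in 𝓝 x, max (F y) (G y) = G y := by
  rcases lt_or_gt_of_ne hne with h | h
  · right
    filter_upwards [(isOpen_lt hF hG).mem_nhds h] with y hy using max_eq_right (le_of_lt hy)
  · left
    filter_upwards [(isOpen_lt hG hF).mem_nhds h] with y hy using max_eq_left (le_of_lt hy)

lemma ae_line_ne {a b : ℝ} (hab : a ≠ 0 ∨ b ≠ 0) (c : ℝ) :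
    ∀ᵐ x : ℝ × ℝ ∂(volume.restrict square), a * x.1 + b * x.2 ≠ c := by
  refine ae_restrict_of_ae ?_
  simpa [ae_iff] using volume_line hab c

/-- The exceptional set is the six lines on which two of the four affine pieces tie; `q < 1` keeps
these lines nondegenerate. -/
lemma ae_menuUtility_affine {α β q : ℝ} (hq1 : q < 1) :
    ∀ᵐ x : ℝ × ℝ ∂(volume.restrict square), ∃ g : ℝ × ℝ,
      (g = (0, 0) ∨ g = (1, 1) ∨ g = (q, 1) ∨ g = (1, q)) ∧
      ∃ k : ℝ, ∀ᶠ y in 𝓝 x, menuUtility α β q y = y.1 * g.1 + y.2 * g.2 + k := by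
  have hq : 1 - q ≠ 0 := by linarith
  filter_upwards [ae_line_ne (a := 1) (b := 1) (by simp) (1 - β),
    ae_line_ne (a := q) (b := 1) (by simp) (1 - α),
    ae_line_ne (a := 1) (b := q) (by simp) (1 - α),
    ae_line_ne (a := 1 - q) (b := 0) (by simp [hq]) (α - β),
    ae_line_ne (a := 0) (b := 1 - q) (by simp [hq]) (α - β),
    ae_line_ne (a := 1 - q) (b := -(1 - q)) (by simp [hq]) 0] with x h1 h2 h3 h4 h5 h6
  have c0 : Continuous fun _ : ℝ × ℝ => (0 : ℝ) := by fun_prop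
  have c1 : Continuous fun y : ℝ × ℝ => β + y.1 + y.2 - 1 := by fun_prop
  have c2 : Continuous fun y : ℝ × ℝ => α + q * y.1 + y.2 - 1 := by fun_prop
  have c3 : Continuous fun y : ℝ × ℝ => α + q * y.2 + y.1 - 1 := by fun_prop
  have finish : ∀ {F G : ℝ × ℝ → ℝ}, Continuous F → Continuous G → F x ≠ G x →
      (∀ᶠ y in 𝓝 x, max 0 (β + y.1 + y.2 - 1) = F y) →
      (∀ᶠ y in 𝓝 x, max (α + q * y.1 + y.2 - 1) (α + q * y.2 + y.1 - 1) = G y) →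
      (∀ᶠ y in 𝓝 x, menuUtility α β q y = F y) ∨ ∀ᶠ y in 𝓝 x, menuUtility α β q y = G y := by
    intro F G hF hG hne hFe hGe
    refine (eventually_max_eq hF hG hne).imp (fun h => ?_) fun h => ?_ <;>
    · filter_upwards [hFe, hGe, h] with y e1 e2 e3
      rw [menuUtility, e1, e2, e3]
  have out0 : (∀ᶠ y in 𝓝 x, menuUtility α β q y = 0) → ∃ g : ℝ × ℝ,
      (g = (0, 0) ∨ g = (1, 1) ∨ g = (q, 1) ∨ g = (1, q)) ∧
      ∃ k : ℝ, ∀ᶠ y in 𝓝 x, menuUtility α β q y = y.1 * g.1 + y.2 * g.2 + k := fun h =>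
    ⟨(0, 0), by simp, 0, h.mono fun y hy => by rw [hy]; ring⟩
  have out1 : (∀ᶠ y in 𝓝 x, menuUtility α β q y = β + y.1 + y.2 - 1) → ∃ g : ℝ × ℝ,
      (g = (0, 0) ∨ g = (1, 1) ∨ g = (q, 1) ∨ g = (1, q)) ∧
      ∃ k : ℝ, ∀ᶠ y in 𝓝 x, menuUtility α β q y = y.1 * g.1 + y.2 * g.2 + k := fun h =>
    ⟨(1, 1), by simp, β - 1, h.mono fun y hy => by rw [hy]; ring⟩
  have out2 : (∀ᶠ y in 𝓝 x, menuUtility α β q y = α + q * y.1 + y.2 - 1) → ∃ g : ℝ × ℝ,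
      (g = (0, 0) ∨ g = (1, 1) ∨ g = (q, 1) ∨ g = (1, q)) ∧
      ∃ k : ℝ, ∀ᶠ y in 𝓝 x, menuUtility α β q y = y.1 * g.1 + y.2 * g.2 + k := fun h =>
    ⟨(q, 1), by simp, α - 1, h.mono fun y hy => by rw [hy]; ring⟩
  have out3 : (∀ᶠ y in 𝓝 x, menuUtility α β q y = α + q * y.2 + y.1 - 1) → ∃ g : ℝ × ℝ,
      (g = (0, 0) ∨ g = (1, 1) ∨ g = (q, 1) ∨ g = (1, q)) ∧
      ∃ k : ℝ, ∀ᶠ y in 𝓝 x, menuUtility α β q y = y.1 * g.1 + y.2 * g.2 + k := fun h =>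
    ⟨(1, q), by simp, α - 1, h.mono fun y hy => by rw [hy]; ring⟩
  rcases eventually_max_eq c0 c1 (x := x) (fun h => h1 (by linarith)) with e | e <;>
    rcases eventually_max_eq c2 c3 (x := x) (fun h => h6 (by linarith)) with e' | e'
  · exact (finish c0 c2 (fun h => h2 (by linarith)) e e').elim out0 out2
  · exact (finish c0 c3 (fun h => h3 (by linarith)) e e').elim out0 out3
  · exact (finish c1 c2 (fun h => h4 (by linarith)) e e').elim out1 out2
  · exact (finish c1 c3 (fun h => h5 (by linarith)) e e').elim out1 out3

lemma active_of_utility_eq_menu {f p : ℝ × ℝ → ℝ} {α β q : ℝ} (hq1 : q < 1)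
    (hu : ∀ x ∈ interior square, utility p x = menuUtility α β q x) {b : ℝ × ℝ}
    (hb : IsActive f p b) : b = (q, 1) ∨ b = (1, q) ∨ b = (1, 1) := by
  obtain ⟨-, hb0, hb⟩ := hb
  by_contra! hcon
  obtain ⟨n1, n2, n3⟩ := hcon
  set D : ℝ × ℝ → ℝ := fun g => Real.sqrt ((g.1 - b.1) ^ 2 + (g.2 - b.2) ^ 2) with hD
  have hDpos : ∀ g, b ≠ g → 0 < D g := by
    intro g hg
    refine Real.sqrt_pos.2 ?_
    by_contra! h
    have e1 : (g.1 - b.1) ^ 2 = 0 := by nlinarith [sq_nonneg (g.1 - b.1), sq_nonneg (g.2 - b.2)]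
    have e2 : (g.2 - b.2) ^ 2 = 0 := by nlinarith [sq_nonneg (g.1 - b.1), sq_nonneg (g.2 - b.2)]
    refine hg (Prod.ext ?_ ?_)
    · exact (sub_eq_zero.1 (pow_eq_zero_iff two_ne_zero |>.1 e1)).symm
    · exact (sub_eq_zero.1 (pow_eq_zero_iff two_ne_zero |>.1 e2)).symm
  -- Almost every type demands only one of the four slopes, so within the smallest distance from `b`
  -- to them the demand is null. The slope `(0, 0)` is excluded because active bundles are nonzero.
  obtain ⟨δ, hδ, hδD⟩ : ∃ δ > 0, ∀ g : ℝ × ℝ,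
      (g = (0, 0) ∨ g = (1, 1) ∨ g = (q, 1) ∨ g = (1, q)) → δ ≤ D g := by
    refine ⟨min (min (D (0, 0)) (D (1, 1))) (min (D (q, 1)) (D (1, q))),
      lt_min (lt_min (hDpos _ hb0) (hDpos _ n3)) (lt_min (hDpos _ n1) (hDpos _ n2)), ?_⟩
    rintro g (rfl | rfl | rfl | rfl)
    · exact (min_le_left _ _).trans (min_le_left _ _)
    · exact (min_le_left _ _).trans (min_le_right _ _)
    · exact (min_le_right _ _).trans (min_le_left _ _)
    · exact (min_le_right _ _).trans (min_le_right _ _)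
  refine (hb δ hδ).ne' (measure_eq_zero_iff_ae_notMem.2 ?_)
  refine (withDensity_absolutelyContinuous _ _).ae_le ?_
  have hint : ∀ᵐ x ∂(volume.restrict square), x ∈ interior square :=
    ae_restrict_square fun x hx => hx
  filter_upwards [ae_menuUtility_affine (α := α) (β := β) hq1, hint] with x hx hxi hmem
  obtain ⟨g, hg, k, hk⟩ := hx
  simp only [mem_iUnion] at hmem
  obtain ⟨r, ⟨-, hr⟩, hxr⟩ := hmem
  have hk' : ∀ᶠ y in 𝓝 x, utility p y = y.1 * g.1 + y.2 * g.2 + k := by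
    filter_upwards [hk, isOpen_interior.mem_nhds hxi] with y h1 h2
    rw [hu y h2, h1]
  obtain rfl := eq_of_mem_demandSet hxi hk' hxr
  exact absurd hr (not_lt.2 (hδD r hg))

end

end TwoGoods

end

theorem corollary2 (f : ℝ × ℝ → ℝ) (hf : TwoGoods.IsSRS f)
    (hζ : ConvexOn ℝ (Ioo (0 : ℝ) 1) (TwoGoods.zeta f))
    (p : ℝ × ℝ → ℝ) (hp : TwoGoods.IsOptimal f p) (hsymm : TwoGoods.IsSymmetricMechanism p) :
    ∃ a q : ℝ, 0 ≤ a ∧ a < 1 ∧ 0 ≤ q ∧ q < 1 ∧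
      (∀ x ∈ Ico (0 : ℝ) a, HasDerivWithinAt (TwoGoods.ubar p) q (Icc 0 1) x) ∧
      (∀ x ∈ Icc a 1, HasDerivWithinAt (TwoGoods.ubar p) 1 (Icc a 1) x) ∧
      ∀ b : ℝ × ℝ, TwoGoods.IsActive f p b → b = (q, 1) ∨ b = (1, q) ∨ b = (1, 1) := by
  obtain ⟨α, β, q, τ, hq0, hq1, hτ1, hτ0, hατ, hubar, hu⟩ := hf.exists_menu_eq hζ hp hsymm
  have hq : 0 < 1 - q := by linarith
  -- The kink is where the two lines meet, truncated at `0`. It comes no later than `τ`, which keeps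
  -- it below `1`.
  have haτ : (α - β) / (1 - q) ≤ τ := by
    rw [div_le_iff₀ hq]
    linarith
  refine ⟨max 0 ((α - β) / (1 - q)), q, le_max_left _ _, max_lt one_pos (haτ.trans_lt hτ1), hq0,
    hq1, fun x hx => ?_, fun x hx => ?_, fun b hb => TwoGoods.active_of_utility_eq_menu hq1 hu hb⟩
  · have hlin : ∀ y ∈ Icc (0 : ℝ) 1, y < max 0 ((α - β) / (1 - q)) →
        TwoGoods.ubar p y = α + q * y := fun y hy hya => by
      have : y < (α - β) / (1 - q) := (lt_max_iff.1 hya).resolve_left (not_lt.2 hy.1)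
      rw [lt_div_iff₀ hq] at this
      rw [hubar y hy, max_eq_left (by linarith)]
    have hd : HasDerivWithinAt (fun y : ℝ => α + q * y) q (Icc 0 1) x := by
      simpa using (((hasDerivAt_id x).const_mul q).const_add α).hasDerivWithinAt
    have hx1 : x ∈ Icc (0 : ℝ) 1 :=
      ⟨hx.1, (hx.2.trans (max_lt one_pos (haτ.trans_lt hτ1))).le⟩
    refine hd.congr_of_eventuallyEq ?_ (hlin x hx1 hx.2)
    filter_upwards [self_mem_nhdsWithin, mem_nhdsWithin_of_mem_nhds (Iio_mem_nhds hx.2)] with y h1 h2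
    exact hlin y h1 h2
  · have hlin : ∀ y ∈ Icc (max 0 ((α - β) / (1 - q))) 1, TwoGoods.ubar p y = β + y := fun y hy => by
      have : (α - β) / (1 - q) ≤ y := (le_max_right _ _).trans hy.1
      rw [div_le_iff₀ hq] at this
      rw [hubar y ⟨(le_max_left _ _).trans hy.1, hy.2⟩, max_eq_right (by linarith)]
    exact (((hasDerivAt_id x).const_add β).hasDerivWithinAt).congr hlin (hlin x hx)
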